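/- Let $\mathsf H$ be a separable complex Hilbert space, let $A,B$ be bounded selfadjoint operators on $\mathsf H$, and let $P^{(A)},P^{(B)}$ be their projection-valued measures on $\mathbb R$. A regularizing sequence is a sequence $Q=(Q_n)_{n}$ of orthogonal projections onto finite-dimensional subspaces of $\mathsf H$ with $Q_n\to I$ strongly. For $N\ge 1$, $\phi,\psi\in\mathsf H$ and such a $Q$, let $\nu^{(N,n)}_{\phi,\psi,Q}$ be the unique complex Borel measure on $\mathbb R^{2N}$ such that, for all Borel sets $I_\ell,J_\ell\subset\mathbb R$, $$\nu^{(N,n)}_{\phi,\psi,Q}(I_1\times J_1\times\cdots\times I_N\times J_N)=\langle\phi\,|\,P^{(A)}_{I_1}Q_nP^{(B)}_{J_1}Q_nP^{(A)}_{I_2}Q_nP^{(B)}_{J_2}Q_n\cdots Q_nP^{(A)}_{I_N}Q_nP^{(B)}_{J_N}\psi\rangle ,$$ with one factor $Q_n$ between any two consecutive spectral projections. For $F:\mathbb R^{2N}\to\mathbb R$, the operator $$\int_{\mathbb R^{2N}}F\,dP^{(A)}_{\lambda_1}dP^{(B)}_{\mu_1}\cdots dP^{(A)}_{\lambda_N}dP^{(B)}_{\mu_N}$$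 denotes the bounded operator $T$ on $\mathsf H$ such that $\langle\phi|T\psi\rangle=\lim_{n\to\infty}\int_{\mathbb R^{2N}}F\,d\nu^{(N,n)}_{\phi,\psi,Q}$ for all $\phi,\psi\in\mathsf H$ (with $F$ integrable for all these measures). Write $\bar\lambda=\frac1N\sum_{l=1}^N\lambda_l$ and $\bar\mu=\frac1N\sum_{l=1}^N\mu_l$. For $p,q\ge 0$ let $S_{p+q}(A^pB^q)$ be $\binom{p+q}{q}^{-1}$ times the sum of all $\binom{p+q}{q}$ products of $p$ factors $A$ and $q$ factors $B$ in all distinct orders. For each integrand $F$ below and every $N\ge 1$, the operator $\int F\,dP^{(A)}_{\lambda_1}\cdots dP^{(B)}_{\mu_N}$ exists, is the unique operator with its defining property, and does not depend on $Q$. Moreover, with limits in the strong operator topology: (a) for all $a,b\in\mathbb R$, $$aA+bB=\mathop{\text{s-}\lim}_{N\to\infty}\int_{\mathbb R^{2N}}(a\bar\lambda+b\bar\mu)\,dP^{(A)}_{\lambda_1}dP^{(B)}_{\mu_1}\cdots dP^{(A)}_{\lambda_N}dP^{(B)}_{\mu_N};$$ (b) the Jordan product $A\circ B=\frac12(AB+BA)$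 satisfies $$A\circ B=\mathop{\text{s-}\lim}_{N\to\infty}\int_{\mathbb R^{2N}}\bar\lambda\,\bar\mu\;dP^{(A)}_{\lambda_1}dP^{(B)}_{\mu_1}\cdots dP^{(A)}_{\lambda_N}dP^{(B)}_{\mu_N};$$ (c) each $S_{p+q}(A^pB^q)$ is selfadjoint, and if $c_{p,q}\in\mathbb R$ $(p,q\ge 0)$ are coefficients of which only finitely many do not vanish, then $$\sum_{p,q}c_{p,q}S_{p+q}(A^pB^q)=\mathop{\text{s-}\lim}_{N\to\infty}\int_{\mathbb R^{2N}}\sum_{p,q}c_{p,q}\,\bar\lambda^{\,p}\bar\mu^{\,q}\;dP^{(A)}_{\lambda_1}dP^{(B)}_{\mu_1}\cdots dP^{(A)}_{\lambda_N}dP^{(B)}_{\mu_N}.$$ -/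

import Mathlib

open MeasureTheory Filter Topology

noncomputable section

namespace RegularizedIntegral

variable {H : Type*} [NormedAddCommGroup H] [InnerProductSpace ℂ H] [CompleteSpace H]

/-- A projection-valued measure on the Borel sets of `ℝ`: orthogonal projections `proj E`, with
`proj ℝ = 1`, σ-additive in the strong operator topology. As for Mathlib's vector measures, sets
that are not measurable are sent to `0`. -/
structure PVM (H : Type*) [NormedAddCommGroup H] [InnerProductSpace ℂ H] [CompleteSpace H] where
  proj : Set ℝ → H →L[ℂ] H
  isStarProjection_proj : ∀ E, MeasurableSet E → IsStarProjection (proj E)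
  proj_univ : proj Set.univ = 1
  proj_of_not_measurableSet : ∀ E, ¬ MeasurableSet E → proj E = 0
  hasSum_proj : ∀ E : ℕ → Set ℝ, (∀ k, MeasurableSet (E k)) →
    Pairwise (Function.onFun Disjoint E) → ∀ ψ : H,
      HasSum (fun k => proj (E k) ψ) (proj (⋃ k, E k) ψ)

theorem PVM.proj_empty (P : PVM H) : P.proj ∅ = 0 := by
  ext ψ
  have h := P.hasSum_proj (fun _ => ∅) (fun _ => MeasurableSet.empty)
    (fun _ _ _ => disjoint_bot_left) ψ
  have h' := h.summable.tendsto_atTop_zero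
  simpa using tendsto_nhds_unique (tendsto_const_nhds (x := P.proj ∅ ψ) (f := atTop (α := ℕ))) h'

/-- The complex Borel measure `E ↦ ⟨φ, P_E ψ⟩` (the inner product is antilinear in `φ`). -/
def PVM.complexMeasure (P : PVM H) (φ ψ : H) : ComplexMeasure ℝ where
  measureOf' E := inner ℂ φ (P.proj E ψ)
  empty' := by simp [P.proj_empty]
  not_measurable' E hE := by simp [P.proj_of_not_measurableSet E hE]
  m_iUnion' E hE hd := (P.hasSum_proj E hE hd ψ).mapL (innerSL ℂ φ)

/-- `P` is the projection-valued measure of the bounded selfadjoint operator `A`, that is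
`A = ∫ t dP(t)`: for all `φ, ψ` the identity function is integrable with respect to (the total
variation of) `E ↦ ⟨φ, P_E ψ⟩`, and its integral is `⟨φ, A ψ⟩`. -/
def PVM.IsSpectralMeasureOf (P : PVM H) (A : H →L[ℂ] H) : Prop :=
  ∀ φ ψ : H, (P.complexMeasure φ ψ).Integrable (fun t : ℝ => t) ∧
    inner ℂ φ (A ψ) = ∫ᵛ t, t ∂•(P.complexMeasure φ ψ)

section SpectralTheorem

theorem exists_diagonal_measure (A : H →L[ℂ] H) (hA : IsSelfAdjoint A) (ψ : H) :
    ∃ μ : Measure ℝ, IsFiniteMeasure μ ∧ (∀ᵐ x ∂μ, x ∈ spectrum ℝ A) ∧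
      ∀ f : ℝ → ℝ, Continuous f → ∫ x, f x ∂μ = (inner ℂ ψ (cfc f A ψ)).re := by
  let Λ₀ : C(spectrum ℝ A, ℝ) →ₗ[ℝ] ℝ :=
    { toFun := fun f => (inner ℂ ψ (cfcHom (R := ℝ) hA f ψ)).re
      map_add' := by intro f g; simp
      map_smul' := by
        intro c f
        rw [map_smul, _root_.smul_apply, ← Complex.coe_smul, inner_smul_right]
        simp }
  let Λ : CompactlySupportedContinuousMap (spectrum ℝ A) ℝ →ₚ[ℝ] ℝ :=
    PositiveLinearMap.mk₀
      { toFun := fun f => Λ₀ f.toContinuousMap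
        map_add' := by intro f g; exact map_add Λ₀ f.toContinuousMap g.toContinuousMap
        map_smul' := by intro c f; exact map_smul Λ₀ c f.toContinuousMap }
      (by
        intro f hf
        have h1 : 0 ≤ cfcHom (R := ℝ) hA f.toContinuousMap := by
          rw [cfcHom_nonneg_iff]
          exact fun x => hf x
        exact (ContinuousLinearMap.nonneg_iff_isPositive _ |>.1 h1).re_inner_nonneg_right ψ)
  refine ⟨(RealRMK.rieszMeasure Λ).map Subtype.val, inferInstance, ?_, ?_⟩
  · rw [ae_map_iff (p := fun x => x ∈ spectrum ℝ A) measurable_subtype_coe.aemeasurable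
      (spectrum.isClosed (𝕜 := ℝ) A).measurableSet]
    exact Eventually.of_forall fun x => x.2
  · intro f hf
    rw [integral_map (by fun_prop) hf.aestronglyMeasurable, cfc_apply f A hA hf.continuousOn]
    exact RealRMK.integral_rieszMeasure Λ
      ⟨⟨fun x => f x, by fun_prop⟩, HasCompactSupport.of_compactSpace _⟩

theorem exists_approx (m : Measure ℝ) [IsFiniteMeasure m] (E : Set ℝ) (hE : MeasurableSet E) :
    ∃ g : ℕ → ℝ → ℝ, (∀ n, Continuous (g n)) ∧ (∀ n x, |g n x| ≤ 1) ∧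
      ∀ᵐ x ∂m, Tendsto (fun n => g n x) atTop (𝓝 (E.indicator 1 x)) := by
  have hint : Integrable (E.indicator (1 : ℝ → ℝ)) m := (integrable_const (1:ℝ)).indicator hE
  have hε : ∀ n : ℕ, ((n : ENNReal) + 1)⁻¹ ≠ 0 := fun n => by simp
  have key := fun n : ℕ => (memLp_one_iff_integrable.2 hint).exists_boundedContinuous_eLpNorm_sub_le
    ENNReal.one_ne_top (hε n)
  choose h h1 h2 using key
  have hm : TendstoInMeasure m (fun n x => h n x) atTop (E.indicator 1) := by
    refine tendstoInMeasure_of_tendsto_eLpNorm one_ne_zero (fun n => (h2 n).1) hint.1 ?_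
    refine tendsto_of_tendsto_of_tendsto_of_le_of_le tendsto_const_nhds
      (by simpa using ENNReal.tendsto_inv_nat_nhds_zero.comp (tendsto_add_atTop_nat 1)) (fun n => zero_le) (fun n => ?_)
    rw [eLpNorm_sub_comm]
    simpa using! h1 n
  obtain ⟨ns, -, hns⟩ := hm.exists_seq_tendsto_ae
  refine ⟨fun n x => max (-1) (min 1 (h (ns n) x)), fun n => by fun_prop, fun n x => ?_, ?_⟩
  · rw [abs_le]; constructor <;> simp
  · filter_upwards [hns] with x hx
    have : Tendsto (fun n => max (-1:ℝ) (min 1 (h (ns n) x))) atTop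
      (𝓝 (max (-1) (min 1 (E.indicator 1 x)))) :=
        (tendsto_const_nhds.max (tendsto_const_nhds.min hx))
    convert this using 2
    by_cases hx : x ∈ E <;> simp [hx]


/-- `g` is a bounded sequence of continuous functions converging `m`-a.e. to the indicator of `E`. -/
def Approximates (m : Measure ℝ) (E : Set ℝ) (g : ℕ → ℝ → ℝ) : Prop :=
  (∀ n, Continuous (g n)) ∧ (∃ C : ℝ, ∀ n x, |g n x| ≤ C) ∧
    ∀ᵐ x ∂m, Tendsto (fun n => g n x) atTop (𝓝 (E.indicator 1 x))

theorem exists_approximates (m : Measure ℝ) [IsFiniteMeasure m] {E : Set ℝ}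
    (hE : MeasurableSet E) : ∃ g, Approximates m E g :=
  let ⟨g, h1, h2, h3⟩ := exists_approx m E hE
  ⟨g, h1, ⟨1, h2⟩, h3⟩

theorem approximates_add_measure {m m' : Measure ℝ} {E : Set ℝ} {g : ℕ → ℝ → ℝ} :
    Approximates (m + m') E g ↔ Approximates m E g ∧ Approximates m' E g := by
  simp only [Approximates, ae_add_measure_iff]; tauto

theorem Approximates.tendsto_integral {m : Measure ℝ} [IsFiniteMeasure m] {E : Set ℝ}
    (hE : MeasurableSet E) {g : ℕ → ℝ → ℝ} (hg : Approximates m E g) :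
    Tendsto (fun n => ∫ x, g n x ∂m) atTop (𝓝 (m.real E)) := by
  obtain ⟨h1, ⟨C, h2⟩, h3⟩ := hg
  rw [← integral_indicator_one hE]
  exact tendsto_integral_of_dominated_convergence (fun _ => C)
    (fun n => (h1 n).aestronglyMeasurable) (integrable_const C)
    (fun n => Eventually.of_forall (h2 n)) h3

theorem norm_sq_cfc {A : H →L[ℂ] H} {μ : Measure ℝ} {ψ : H}
    (hμ : ∀ f : ℝ → ℝ, Continuous f → ∫ x, f x ∂μ = (inner ℂ ψ (cfc f A ψ)).re)
    {f : ℝ → ℝ} (hf : Continuous f) : ‖cfc f A ψ‖ ^ 2 = ∫ x, f x * f x ∂μ := by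
  rw [hμ (fun x => f x * f x) (hf.mul hf), cfc_mul f f A hf.continuousOn hf.continuousOn]
  have h : IsSelfAdjoint (cfc f A) := cfc_predicate f A
  rw [mul_apply_eq_comp, ← ContinuousLinearMap.adjoint_inner_left,
    ← ContinuousLinearMap.star_eq_adjoint, h.star_eq]
  exact (inner_self_eq_norm_sq (𝕜 := ℂ) _).symm

theorem tendsto_norm_cfc_sub {A : H →L[ℂ] H} {μ : Measure ℝ} [IsFiniteMeasure μ] {ψ : H}
    (hμ : ∀ f : ℝ → ℝ, Continuous f → ∫ x, f x ∂μ = (inner ℂ ψ (cfc f A ψ)).re)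
    {E : Set ℝ} {g h : ℕ → ℝ → ℝ} (hg : Approximates μ E g) (hh : Approximates μ E h)
    {ι : Type*} {l : Filter ι} [l.IsCountablyGenerated] {u v : ι → ℕ}
    (hu : Tendsto u l atTop) (hv : Tendsto v l atTop) :
    Tendsto (fun i => ‖cfc (g (u i)) A ψ - cfc (h (v i)) A ψ‖) l (𝓝 0) := by
  obtain ⟨g1, ⟨C, g2⟩, g3⟩ := hg
  obtain ⟨h1, ⟨D, h2⟩, h3⟩ := hh
  have key : Tendsto (fun i => ‖cfc (g (u i)) A ψ - cfc (h (v i)) A ψ‖ ^ 2) l (𝓝 0) := by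
    have e : ∀ i, ‖cfc (g (u i)) A ψ - cfc (h (v i)) A ψ‖ ^ 2 =
        ∫ x, (g (u i) x - h (v i) x) * (g (u i) x - h (v i) x) ∂μ := by
      intro i
      rw [← norm_sq_cfc (f := fun x => g (u i) x - h (v i) x) hμ ((g1 _).sub (h1 _)),
        cfc_sub (g (u i)) (h (v i)) A (g1 _).continuousOn (h1 _).continuousOn, sub_apply]
    simp_rw [e]
    have := tendsto_integral_filter_of_dominated_convergence (μ := μ) (l := l)
      (F := fun i x => (g (u i) x - h (v i) x) * (g (u i) x - h (v i) x)) (f := fun _ => 0)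
      (fun _ => (C + D) * (C + D))
      (Eventually.of_forall fun i =>
        (((g1 _).sub (h1 _)).mul ((g1 _).sub (h1 _))).aestronglyMeasurable)
      (Eventually.of_forall fun i => Eventually.of_forall fun x => ?_) (integrable_const _) ?_
    · simpa using this
    · have : |g (u i) x - h (v i) x| ≤ C + D :=
        (abs_sub _ _).trans (add_le_add (g2 _ _) (h2 _ _))
      rw [Real.norm_eq_abs, abs_mul]
      exact mul_self_le_mul_self (abs_nonneg _) this
    · filter_upwards [g3, h3] with x hx hx'
      have := (hx.comp hu).sub (hx'.comp hv)
      simpa using this.mul this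
  have := key.sqrt
  simpa using this

theorem exists_proj {A : H →L[ℂ] H} {μ : H → Measure ℝ} [∀ ψ, IsFiniteMeasure (μ ψ)]
    (hμ : ∀ ψ, ∀ f : ℝ → ℝ, Continuous f → ∫ x, f x ∂(μ ψ) = (inner ℂ ψ (cfc f A ψ)).re)
    {E : Set ℝ} (hE : MeasurableSet E) : ∃ T : H →L[ℂ] H, IsStarProjection T ∧
      (∀ ψ g, Approximates (μ ψ) E g → Tendsto (fun n => cfc (g n) A ψ) atTop (𝓝 (T ψ))) ∧
      ∀ ψ, inner ℂ ψ (T ψ) = ((μ ψ).real E : ℂ) := by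
  have ex : ∀ ψ, ∃ v, ∀ g, Approximates (μ ψ) E g →
      Tendsto (fun n => cfc (g n) A ψ) atTop (𝓝 v) := by
    intro ψ
    obtain ⟨g, hg⟩ := exists_approximates (μ ψ) hE
    have hc : CauchySeq (fun n => cfc (g n) A ψ) := by
      rw [cauchySeq_iff_tendsto_dist_atTop_0]
      simp_rw [dist_eq_norm]
      rw [← prod_atTop_atTop_eq]
      exact tendsto_norm_cfc_sub (hμ ψ) hg hg tendsto_fst tendsto_snd
    obtain ⟨v, hv⟩ := cauchySeq_tendsto_of_complete hc
    refine ⟨v, fun h hh => ?_⟩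
    have := tendsto_norm_cfc_sub (hμ ψ) hg hh tendsto_id tendsto_id
    exact (tendsto_iff_of_dist (by simpa only [dist_eq_norm, id] using this)).1 hv
  choose T hT using ex
  have inn : ∀ φ ψ, inner ℂ (T φ) (T ψ) = inner ℂ φ (T ψ) := by
    intro φ ψ
    obtain ⟨g, hg⟩ := exists_approximates (μ φ + μ ψ) hE
    have hφ := (approximates_add_measure.1 hg).1
    have hψ := (approximates_add_measure.1 hg).2
    have hψ2 : Approximates (μ ψ) E (fun n x => g n x * g n x) := by
      obtain ⟨g1, ⟨C, g2⟩, g3⟩ := hψ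
      refine ⟨fun n => (g1 n).mul (g1 n), ⟨C * C, fun n x => ?_⟩, ?_⟩
      · have := g2 n x
        have := abs_nonneg (g n x)
        rw [abs_mul]; gcongr
        linarith
      · filter_upwards [g3] with x hx
        convert hx.mul hx using 2
        by_cases hx : x ∈ E <;> simp [hx]
    have t1 := (hT φ g hφ).inner (𝕜 := ℂ) (hT ψ g hψ)
    have t2 := (tendsto_const_nhds (x := φ)).inner (𝕜 := ℂ) (hT ψ _ hψ2)
    refine tendsto_nhds_unique t1 (t2.congr fun n => ?_)
    have h : IsSelfAdjoint (cfc (g n) A) := cfc_predicate _ A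
    rw [cfc_mul (g n) (g n) A (hg.1 n).continuousOn (hg.1 n).continuousOn,
      mul_apply_eq_comp, ← ContinuousLinearMap.adjoint_inner_left,
      ← ContinuousLinearMap.star_eq_adjoint, h.star_eq]
  have add : ∀ φ ψ, T (φ + ψ) = T φ + T ψ := by
    intro φ ψ
    obtain ⟨g, hg⟩ := exists_approximates (μ φ + μ ψ + μ (φ + ψ)) hE
    obtain ⟨⟨h1, h2⟩, h3⟩ : (_ ∧ _) ∧ _ := by simpa only [approximates_add_measure] using hg
    refine tendsto_nhds_unique (hT _ g h3) (((hT _ g h1).add (hT _ g h2)).congr fun n => ?_)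
    rw [map_add]
  have smul : ∀ (c : ℂ) ψ, T (c • ψ) = c • T ψ := by
    intro c ψ
    obtain ⟨g, hg⟩ := exists_approximates (μ ψ + μ (c • ψ)) hE
    obtain ⟨h1, h2⟩ := approximates_add_measure.1 hg
    refine tendsto_nhds_unique (hT _ g h2) (((hT _ g h1).const_smul c).congr fun n => ?_)
    rw [map_smul]
  have bdd : ∀ ψ, ‖T ψ‖ ≤ 1 * ‖ψ‖ := by
    intro ψ
    have h1 : ‖T ψ‖ * ‖T ψ‖ ≤ ‖ψ‖ * ‖T ψ‖ := by
      rw [← sq, ← inner_self_eq_norm_sq (𝕜 := ℂ), inn]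
      exact (RCLike.re_le_norm _).trans (norm_inner_le_norm _ _)
    rcases (norm_nonneg (T ψ)).eq_or_lt with h | h
    · rw [← h]; positivity
    · rw [one_mul]; exact le_of_mul_le_mul_right h1 h
  let T' : H →L[ℂ] H := LinearMap.mkContinuous
    { toFun := T, map_add' := add, map_smul' := smul } 1 bdd
  have hadj : star T' * T' = T' := by
    ext ψ
    refine ext_inner_left ℂ fun φ => ?_
    rw [mul_apply_eq_comp, ContinuousLinearMap.star_eq_adjoint,
      ContinuousLinearMap.adjoint_inner_right]
    exact inn φ ψ
  have hsa : IsSelfAdjoint T' := by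
    rw [← hadj]; exact IsSelfAdjoint.star_mul_self T'
  refine ⟨T', ⟨?_, hsa⟩, hT, fun ψ => ?_⟩
  · rw [hsa.star_eq] at hadj; exact hadj
  · change inner ℂ ψ (T ψ) = _
    apply Complex.ext
    · obtain ⟨g, hg⟩ := exists_approximates (μ ψ) hE
      have t2 := (tendsto_const_nhds (x := ψ)).inner (𝕜 := ℂ) (hT ψ _ hg)
      have t3 := (Complex.continuous_re.tendsto _).comp t2
      refine tendsto_nhds_unique t3 ?_
      have := hg.tendsto_integral hE
      simp_rw [hμ ψ _ (hg.1 _)] at this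
      simpa using! this
    · rw [← inn]
      have : (inner ℂ (T ψ) (T ψ)).im = 0 := inner_self_im (𝕜 := ℂ) (T ψ)
      simpa using this


theorem exists_pvm {A : H →L[ℂ] H} (hA : IsSelfAdjoint A) {μ : H → Measure ℝ}
    [∀ ψ, IsFiniteMeasure (μ ψ)]
    (hμ : ∀ ψ, ∀ f : ℝ → ℝ, Continuous f → ∫ x, f x ∂(μ ψ) = (inner ℂ ψ (cfc f A ψ)).re) :
    ∃ P : PVM H, ∀ E, MeasurableSet E → ∀ ψ, inner ℂ ψ (P.proj E ψ) = ((μ ψ).real E : ℂ) := by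
  classical
  have key := fun (E : Set ℝ) (hE : MeasurableSet E) => exists_proj hμ hE
  choose T hT1 hT2 hT3 using key
  have nsq : ∀ E (hE : MeasurableSet E) ψ, ‖T E hE ψ‖ ^ 2 = (μ ψ).real E := by
    intro E hE ψ
    have h := hT3 E hE ψ
    have h2 : inner ℂ (T E hE ψ) (T E hE ψ) = inner ℂ ψ (T E hE ψ) := by
      rw [← ContinuousLinearMap.adjoint_inner_right, ← ContinuousLinearMap.star_eq_adjoint,
        (hT1 E hE).isSelfAdjoint.star_eq, ← mul_apply_eq_comp,
        (hT1 E hE).isIdempotentElem.eq]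
    rw [← inner_self_eq_norm_sq (𝕜 := ℂ), h2, h]
    simp
  have huniv : T Set.univ MeasurableSet.univ = 1 := by
    ext ψ
    have h := hT2 Set.univ MeasurableSet.univ ψ (fun _ _ => 1)
      ⟨fun _ => continuous_const, ⟨1, by simp⟩, by simp⟩
    have h1 : cfc (fun _ : ℝ => (1 : ℝ)) A = 1 := cfc_const_one ℝ A
    rw [h1] at h
    exact tendsto_nhds_unique h tendsto_const_nhds
  have hadd : ∀ E F (hE : MeasurableSet E) (hF : MeasurableSet F), Disjoint E F → ∀ ψ,
      T (E ∪ F) (hE.union hF) ψ = T E hE ψ + T F hF ψ := by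
    intro E F hE hF hd ψ
    obtain ⟨g, hg⟩ := exists_approximates (μ ψ) hE
    obtain ⟨h, hh⟩ := exists_approximates (μ ψ) hF
    have hgh : Approximates (μ ψ) (E ∪ F) (fun n x => g n x + h n x) := by
      obtain ⟨g1, ⟨C, g2⟩, g3⟩ := hg
      obtain ⟨h1, ⟨D, h2⟩, h3⟩ := hh
      refine ⟨fun n => (g1 n).add (h1 n), ⟨C + D, fun n x =>
        (abs_add_le _ _).trans (add_le_add (g2 n x) (h2 n x))⟩, ?_⟩
      filter_upwards [g3, h3] with x hx hx'
      rw [Set.indicator_union_of_disjoint hd]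
      exact hx.add hx'
    refine tendsto_nhds_unique (hT2 _ _ ψ _ hgh) (((hT2 _ hE ψ g hg).add
      (hT2 _ hF ψ h hh)).congr fun n => ?_)
    rw [cfc_add A (g n) (h n) (hg.1 n).continuousOn (hh.1 n).continuousOn, add_apply]
  let S : Set ℝ → H →L[ℂ] H := fun E => if h : MeasurableSet E then T E h else 0
  have hS : ∀ E (hE : MeasurableSet E), S E = T E hE := fun E hE => dif_pos hE
  have hSadd : ∀ E F, MeasurableSet E → MeasurableSet F → Disjoint E F → ∀ ψ,
      S (E ∪ F) ψ = S E ψ + S F ψ := by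
    intro E F hE hF hd ψ
    rw [hS _ hE, hS _ hF, hS _ (hE.union hF), hadd E F hE hF hd]
  have hSempty : ∀ ψ, S ∅ ψ = 0 := by
    intro ψ
    have := hSadd ∅ ∅ MeasurableSet.empty MeasurableSet.empty (Set.disjoint_empty _) ψ
    simpa using this
  refine ⟨⟨S, fun E hE => by rw [hS E hE]; exact hT1 E hE, by rw [hS _ MeasurableSet.univ, huniv],
    fun E hE => dif_neg hE, ?_⟩, fun E hE ψ => by
      change inner ℂ ψ (S E ψ) = _
      rw [hS E hE, hT3]⟩
  intro E hE hd ψ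
  have hsum : ∀ s : Finset ℕ, S (⋃ i ∈ s, E i) ψ = ∑ i ∈ s, S (E i) ψ := by
    intro s
    induction s using Finset.induction_on with
    | empty => simpa using hSempty ψ
    | insert a s ha ih =>
      rw [Finset.set_biUnion_insert, Finset.sum_insert ha, ← ih]
      refine hSadd _ _ (hE a) (Finset.measurableSet_biUnion _ fun i _ => hE i) ?_ ψ
      rw [Set.disjoint_iUnion₂_right]
      intro i hi
      exact hd (fun h => ha (h ▸ hi))
  have hU : MeasurableSet (⋃ i, E i) := MeasurableSet.iUnion hE
  have hsub : ∀ s : Finset ℕ, ‖(∑ i ∈ s, S (E i) ψ) - S (⋃ i, E i) ψ‖ ^ 2 =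
      (μ ψ).real (⋃ i, E i) - ∑ i ∈ s, (μ ψ).real (E i) := by
    intro s
    have hm : MeasurableSet (⋃ i ∈ s, E i) := Finset.measurableSet_biUnion _ fun i _ => hE i
    have hss : (⋃ i ∈ s, E i) ⊆ ⋃ i, E i := Set.iUnion₂_subset_iUnion _ _
    have h1 := hSadd _ _ hm (hU.diff hm) Set.disjoint_sdiff_right ψ
    rw [Set.union_sdiff_cancel hss] at h1
    rw [← hsum, h1, sub_add_cancel_left, norm_neg, hS _ (hU.diff hm), nsq,
      measureReal_sdiff hss hm, measureReal_biUnion_finset (fun i _ j _ h => hd h)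
        (fun i _ => hE i)]
  have hmeas : HasSum (fun i => (μ ψ).real (E i)) ((μ ψ).real (⋃ i, E i)) := by
    have := ((μ ψ).toSignedMeasure).m_iUnion hE hd
    simpa [Measure.toSignedMeasure_apply_measurable, hE, hU] using this
  have hz : Tendsto (fun s : Finset ℕ => ‖(∑ i ∈ s, S (E i) ψ) - S (⋃ i, E i) ψ‖ ^ 2) atTop
      (𝓝 0) := by
    simp_rw [hsub]
    simpa using (tendsto_const_nhds (x := (μ ψ).real (⋃ i, E i))).sub hmeas
  have := hz.sqrt
  simp only [Real.sqrt_sq (norm_nonneg _), Real.sqrt_zero] at this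
  exact tendsto_iff_norm_sub_tendsto_zero.2 this

theorem continuous_integral_of_variation_le {ν : ComplexMeasure ℝ} {M : Measure ℝ}
    (h : ν.variation ≤ M) : Continuous fun f : Lp ℝ 1 M => ∫ᵛ t, f t ∂•ν := by
  have hi : ∀ f : Lp ℝ 1 M, ν.Integrable f := fun f => (L1.integrable_coeFn f).mono_measure h
  refine LipschitzWith.continuous (K := ‖ContinuousLinearMap.lsmul ℝ ℝ (E := ℂ)‖₊)
    (LipschitzWith.of_dist_le_mul fun f g => ?_)
  rw [dist_eq_norm, dist_eq_norm, ← VectorMeasure.integral_sub (hi f) (hi g),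
    L1.norm_eq_integral_norm, integral_congr_ae (f := fun a => ‖(f - g) a‖) ((Lp.coeFn_sub f g).fun_comp norm)]
  refine VectorMeasure.norm_integral_le_integral_norm.trans
    (mul_le_mul_of_nonneg_left ?_ (norm_nonneg (ContinuousLinearMap.lsmul ℝ ℝ (E := ℂ))))
  exact integral_mono_measure h (Eventually.of_forall fun _ => norm_nonneg _)
    ((L1.integrable_coeFn f).sub (L1.integrable_coeFn g)).norm

theorem continuous_integral_of_le {μ M : Measure ℝ} (h : μ ≤ M) :
    Continuous fun f : Lp ℝ 1 M => ∫ t, f t ∂μ := by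
  have hi : ∀ f : Lp ℝ 1 M, Integrable f μ := fun f => (L1.integrable_coeFn f).mono_measure h
  refine LipschitzWith.continuous (K := 1) (LipschitzWith.of_dist_le_mul fun f g => ?_)
  rw [dist_eq_norm, dist_eq_norm, ← integral_sub (hi f) (hi g), NNReal.coe_one, one_mul,
    L1.norm_eq_integral_norm, integral_congr_ae (f := fun a => ‖(f - g) a‖) ((Lp.coeFn_sub f g).fun_comp norm)]
  refine (norm_integral_le_integral_norm _).trans ?_
  exact integral_mono_measure h (Eventually.of_forall fun _ => norm_nonneg _)
    ((L1.integrable_coeFn f).sub (L1.integrable_coeFn g)).norm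

theorem integral_complexMeasure_eq_sum {ν : ComplexMeasure ℝ} {M : Measure ℝ}
    (hν : ν.variation ≤ M) {μ : Fin 4 → Measure ℝ} (hμ : ∀ k, μ k ≤ M) (c : Fin 4 → ℂ)
    [IsFiniteMeasure M] (h : ∀ E, MeasurableSet E → ν E = ∑ k, c k * ((μ k).real E : ℂ))
    {f : ℝ → ℝ} (hf : Integrable f M) : ∫ᵛ t, f t ∂•ν = ∑ k, c k * ((∫ t, f t ∂(μ k) : ℝ) : ℂ) := by
  have hfin : IsFiniteMeasure ν.variation := isFiniteMeasure_of_le M hν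
  refine Integrable.induction
    (P := fun f => ∫ᵛ t, f t ∂•ν = ∑ k, c k * ((∫ t, f t ∂(μ k) : ℝ) : ℂ)) ?_ ?_ ?_ ?_ hf
  · intro r E hE _
    rw [VectorMeasure.integral_indicator_const _ hE]
    simp [h E hE, integral_indicator_const, hE, mul_assoc, mul_comm (r : ℂ)]
  · intro f g _ hf hg h1 h2
    rw [VectorMeasure.integral_add (hf.mono_measure hν) (hg.mono_measure hν), h1, h2,
      ← Finset.sum_add_distrib]
    refine Finset.sum_congr rfl fun k _ => ?_
    rw [integral_add' (hf.mono_measure (hμ k)) (hg.mono_measure (hμ k))]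
    push_cast; ring
  · refine isClosed_eq (continuous_integral_of_variation_le hν) ?_
    exact continuous_finsetSum _ fun k _ => continuous_const.mul
      (Complex.continuous_ofReal.comp (continuous_integral_of_le (hμ k)))
  · intro f g hfg _ h1
    have e1 : ∫ᵛ t, f t ∂•ν = ∫ᵛ t, g t ∂•ν :=
      VectorMeasure.integral_congr_ae (Measure.absolutelyContinuous_of_le hν hfg)
    have e2 : ∀ k, ∫ t, f t ∂(μ k) = ∫ t, g t ∂(μ k) := fun k =>
      integral_congr_ae (Measure.absolutelyContinuous_of_le (hμ k) hfg)
    simpa only [e1, e2] using h1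

theorem inner_polarization {T : H →L[ℂ] H} (hT : IsSelfAdjoint T) (φ ψ : H) :
    inner ℂ φ (T ψ) = ∑ k : Fin 4, (![1, -1, -Complex.I, Complex.I] k / 4) *
      inner ℂ (![φ + ψ, φ - ψ, φ + Complex.I • ψ, φ - Complex.I • ψ] k)
        (T (![φ + ψ, φ - ψ, φ + Complex.I • ψ, φ - Complex.I • ψ] k)) := by
  have hs : ∀ x y, inner ℂ x (T y) = inner ℂ (T x) y := by
    intro x y
    rw [← ContinuousLinearMap.adjoint_inner_left, ← ContinuousLinearMap.star_eq_adjoint, hT.star_eq]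
  have := inner_map_polarization' (T : H →ₗ[ℂ] H) φ ψ
  simp only [ContinuousLinearMap.coe_coe] at this
  simp only [hs, this, Fin.sum_univ_four, Matrix.cons_val]
  ring

/-- The spectral theorem for a bounded selfadjoint operator: its projection-valued measure
exists. -/
theorem exists_pvm_isSpectralMeasureOf (A : H →L[ℂ] H) (hA : IsSelfAdjoint A) :
    ∃ P : PVM H, P.IsSpectralMeasureOf A := by
  choose μ hfin hsp hμ using exists_diagonal_measure A hA
  obtain ⟨P, hP⟩ := exists_pvm hA hμ
  refine ⟨P, fun φ ψ => ?_⟩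
  have nsq : ∀ E, MeasurableSet E → ∀ z, ‖P.proj E z‖ ^ 2 = (μ z).real E := by
    intro E hE z
    have hp := P.isStarProjection_proj E hE
    have h2 : inner ℂ (P.proj E z) (P.proj E z) = inner ℂ z (P.proj E z) := by
      rw [← ContinuousLinearMap.adjoint_inner_right, ← ContinuousLinearMap.star_eq_adjoint,
        hp.isSelfAdjoint.star_eq, ← mul_apply_eq_comp, hp.isIdempotentElem.eq]
    rw [← inner_self_eq_norm_sq (𝕜 := ℂ), h2, hP E hE]
    simp
  let z : Fin 4 → H := ![φ + ψ, φ - ψ, φ + Complex.I • ψ, φ - Complex.I • ψ]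
  let M : Measure ℝ := (μ φ + μ ψ) + ∑ k, μ (z k)
  have hν : (P.complexMeasure φ ψ).variation ≤ M := by
    refine le_trans (VectorMeasure.variation_le_of_forall_enorm_le (m := μ φ + μ ψ) ?_)
      (Measure.le_add_right le_rfl)
    intro E hE
    have hp := P.isStarProjection_proj E hE
    have h2 : inner ℂ φ (P.proj E ψ) = inner ℂ (P.proj E φ) (P.proj E ψ) := by
      rw [← ContinuousLinearMap.adjoint_inner_right, ← ContinuousLinearMap.star_eq_adjoint,
        hp.isSelfAdjoint.star_eq, ← mul_apply_eq_comp, hp.isIdempotentElem.eq]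
    have h3 : ‖inner ℂ φ (P.proj E ψ)‖ ≤ (μ φ + μ ψ).real E := by
      rw [h2, measureReal_add_apply, ← nsq E hE, ← nsq E hE]
      refine (norm_inner_le_norm _ _).trans ?_
      nlinarith [sq_nonneg (‖P.proj E φ‖ - ‖P.proj E ψ‖), sq_nonneg ‖P.proj E φ‖,
        sq_nonneg ‖P.proj E ψ‖]
    change ‖inner ℂ φ (P.proj E ψ)‖ₑ ≤ _
    rw [← ofReal_norm, ← ofReal_measureReal (measure_ne_top _ _)]
    exact ENNReal.ofReal_le_ofReal h3
  have hμM : ∀ k, μ (z k) ≤ M := fun k =>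
    (Measure.le_add_left (Measure.le_iff.2 fun E hE => by
      rw [Measure.finsetSum_apply]
      exact Finset.single_le_sum (f := fun k => μ (z k) E) (fun _ _ => zero_le)
        (Finset.mem_univ k)))
  have hMsp : ∀ᵐ x ∂M, x ∈ spectrum ℝ A := by
    have : ∀ᵐ x ∂(∑ k, μ (z k)), x ∈ spectrum ℝ A := by
      simp only [Fin.sum_univ_four, ae_add_measure_iff]
      exact ⟨⟨⟨hsp _, hsp _⟩, hsp _⟩, hsp _⟩
    simp only [M, ae_add_measure_iff]
    exact ⟨⟨hsp _, hsp _⟩, this⟩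
  have hMfin : IsFiniteMeasure M := by
    simp only [M]; infer_instance
  have hid : Integrable (fun t : ℝ => t) M := by
    obtain ⟨C, hC⟩ := (spectrum.isBounded (𝕜 := ℝ) A).exists_norm_le
    refine Integrable.of_bound (by fun_prop) C ?_
    filter_upwards [hMsp] with x hx using hC x hx
  refine ⟨hid.mono_measure hν, ?_⟩
  rw [integral_complexMeasure_eq_sum hν hμM (fun k => ![1, -1, -Complex.I, Complex.I] k / 4) ?_ hid,
    inner_polarization hA]
  · refine Finset.sum_congr rfl fun k _ => ?_
    congr 1
    rw [hμ _ _ continuous_id', cfc_id' ℝ A]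
    refine Complex.ext rfl ?_
    rw [Complex.ofReal_im]
    refine Complex.conj_eq_iff_im.1 ?_
    rw [inner_conj_symm, ← ContinuousLinearMap.adjoint_inner_right,
      ← ContinuousLinearMap.star_eq_adjoint, hA.star_eq]
  · intro E hE
    change inner ℂ φ (P.proj E ψ) = _
    rw [inner_polarization (P.isStarProjection_proj E hE).isSelfAdjoint]
    exact Finset.sum_congr rfl fun k _ => by rw [hP E hE]

end SpectralTheorem

/-- The projection-valued measure `P^(A)` of the bounded selfadjoint operator `A`. -/
def spectralPVM (A : H →L[ℂ] H) (hA : IsSelfAdjoint A) : PVM H :=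
  (exists_pvm_isSpectralMeasureOf A hA).choose

theorem spectralPVM_isSpectralMeasureOf (A : H →L[ℂ] H) (hA : IsSelfAdjoint A) :
    (spectralPVM A hA).IsSpectralMeasureOf A :=
  (exists_pvm_isSpectralMeasureOf A hA).choose_spec

/-- A regularizing sequence: orthogonal projections onto finite-dimensional subspaces that
converge strongly to the identity. -/
structure IsRegularizing (Q : ℕ → H →L[ℂ] H) : Prop where
  isStarProjection : ∀ n, IsStarProjection (Q n)
  finiteDimensional_range : ∀ n, FiniteDimensional ℂ (LinearMap.range (Q n : H →ₗ[ℂ] H))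
  tendsto : ∀ ψ : H, Tendsto (fun n => Q n ψ) atTop (𝓝 ψ)

/-- The operator `P₁(I₁) R P₂(J₁) R P₁(I₂) R P₂(J₂) R ⋯ R P₁(I_N) R P₂(J_N)`: the `2N` projections
in alternating order, with a factor `R` between any two consecutive ones. -/
def regularizedProduct (P₁ P₂ : PVM H) (R : H →L[ℂ] H) {N : ℕ} (I J : Fin N → Set ℝ) :
    H →L[ℂ] H :=
  ((List.ofFn fun l => P₁.proj (I l) * R * P₂.proj (J l)).intersperse R).prod

/-- `ν` is the complex Borel measure on `ℝ^{2N}` whose value on the box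
`I₁ × J₁ × ⋯ × I_N × J_N` is `⟨φ, P₁(I₁) R P₂(J₁) R ⋯ R P₁(I_N) R P₂(J_N) ψ⟩`. The point
`(λ₁, μ₁, …, λ_N, μ_N)` of `ℝ^{2N}` is the function `x` with `x l = (λ_l, μ_l)`. There is at most
one such measure, because the measurable boxes are a generating π-system. -/
def IsRegularizedMeasure (P₁ P₂ : PVM H) (R : H →L[ℂ] H) (φ ψ : H) {N : ℕ}
    (ν : ComplexMeasure (Fin N → ℝ × ℝ)) : Prop :=
  ∀ I J : Fin N → Set ℝ, (∀ l, MeasurableSet (I l)) → (∀ l, MeasurableSet (J l)) →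
    ν (Set.univ.pi fun l => I l ×ˢ J l) = inner ℂ φ (regularizedProduct P₁ P₂ R I J ψ)

/-- `T` is the operator integral of `F` over `ℝ^{2N}` with respect to
`dP₁(λ₁) dP₂(μ₁) ⋯ dP₁(λ_N) dP₂(μ_N)`, computed with the regularizing sequence `Q`: for all
`φ, ψ` the regularized measures `ν n` exist, `F` is integrable with respect to each of them, and
`⟨φ, T ψ⟩ = lim_n ∫ F dν_n`. -/
def IsOperatorIntegral (P₁ P₂ : PVM H) (Q : ℕ → H →L[ℂ] H) {N : ℕ}
    (F : (Fin N → ℝ × ℝ) → ℝ) (T : H →L[ℂ] H) : Prop :=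
  ∀ φ ψ : H, ∃ ν : ℕ → ComplexMeasure (Fin N → ℝ × ℝ),
    (∀ n, IsRegularizedMeasure P₁ P₂ (Q n) φ ψ (ν n)) ∧
    (∀ n, (ν n).Integrable F) ∧
    Tendsto (fun n => ∫ᵛ x, F x ∂•(ν n)) atTop (𝓝 (inner ℂ φ (T ψ)))

/-- `X` is the strong limit, as `N → ∞`, of the operator integrals of `F N`. For every `N ≥ 1`
the operator integral `T N` is required to exist, to be the same for all regularizing sequences,
and to be the only operator satisfying its defining relation. -/
def IsStrongLimitOfIntegrals (P₁ P₂ : PVM H) (F : (N : ℕ) → (Fin N → ℝ × ℝ) → ℝ)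
    (X : H →L[ℂ] H) : Prop :=
  ∃ T : ℕ → H →L[ℂ] H,
    (∀ N, 1 ≤ N → ∀ Q : ℕ → H →L[ℂ] H, IsRegularizing Q →
      IsOperatorIntegral P₁ P₂ Q (F N) (T N) ∧
      ∀ T' : H →L[ℂ] H, IsOperatorIntegral P₁ P₂ Q (F N) T' → T' = T N) ∧
    ∀ ψ : H, Tendsto (fun N => T N ψ) atTop (𝓝 (X ψ))

/-- The average `(λ₁ + ⋯ + λ_N) / N`. -/
def meanFst {N : ℕ} (x : Fin N → ℝ × ℝ) : ℝ := (∑ l, (x l).1) / N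

/-- The average `(μ₁ + ⋯ + μ_N) / N`. -/
def meanSnd {N : ℕ} (x : Fin N → ℝ × ℝ) : ℝ := (∑ l, (x l).2) / N

/-- The Jordan product `(AB + BA) / 2`. -/
def jordanProduct (A B : H →L[ℂ] H) : H →L[ℂ] H := (1 / 2 : ℝ) • (A * B + B * A)

/-- The symmetrized product `S_{p+q}(A^p B^q)` of `p` copies of `A` and `q` copies of `B`: the
average of the `(p+q choose q)` words of length `p + q` that contain `p` letters `A` (at the
positions in `s`) and `q` letters `B`. -/
def symmetrizedProduct (A B : H →L[ℂ] H) (p q : ℕ) : H →L[ℂ] H :=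
  ((p + q).choose q : ℝ)⁻¹ •
    ∑ s ∈ Finset.powersetCard p (Finset.univ : Finset (Fin (p + q))),
      (List.ofFn fun i => if i ∈ s then A else B).prod

end RegularizedIntegral

end

open RegularizedIntegral

/-! By linearity everything reduces to the integrand `meanFst x ^ p * meanSnd x ^ q`; (a) and (b)
are the cases (1,0), (0,1) and (1,1).

The operator integral of a monomial ∏ λ_l^{k_l} μ_l^{m_l} is the ordered product A^{k_1} B^{m_1} ⋯
A^{k_N} B^{m_N}. Each inserted Q_n is a finite sum ∑ |e_k⟩⟨e_k|, so a matrix element of the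
regularized product is a finite sum of products of matrix elements of single operators, and
polarization makes these diagonal. The regularized measure is therefore a finite complex combination
of product measures, and Fubini turns the integral of the monomial into ⟨φ, A^{k_1} Q_n B^{m_1} Q_n
⋯ ψ⟩ (`exists_isRegularizedMeasure`). Since Q_n → 1 strongly with norms at most 1, the factors Q_n
disappear in the limit (`tendsto_alternatingProduct`).

Expanding in divided powers, the integral of (∑ λ_l)^p (∑ μ_l)^q / (p! q!) is the coefficient of s^p
t^q in E^N, where E = exp(sA) exp(tB) (`sum_pow_mul_sum_pow_mem_orderedPairs`). What remains is a
formal Trotter formula (`tendsto_smul_coeff₂_expSeries_pow`). In E^N = ∑_j C(N,j) (E - 1)^j only j ≤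
p + q contributes to this coefficient. After division by N^{p+q} only j = p + q survives, with
weight 1/(p+q)! and the coefficient of (sA + tB)^{p+q}, which is the sum of all words.
Multiplication by p! q! gives the symmetrized product. The convergence even holds in operator norm.
-/

noncomputable section

namespace RegularizedIntegral

/-! ### Complex measures as combinations of positive measures -/

section Combination

variable {X : Type*} [MeasurableSpace X]

theorem continuous_integral_of_variation_le' {ν : ComplexMeasure X} {M : Measure X}
    (h : ν.variation ≤ M) : Continuous fun f : Lp ℝ 1 M => ∫ᵛ t, f t ∂•ν := by
  have hi : ∀ f : Lp ℝ 1 M, ν.Integrable f := fun f => (L1.integrable_coeFn f).mono_measure h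
  refine LipschitzWith.continuous (K := ‖ContinuousLinearMap.lsmul ℝ ℝ (E := ℂ)‖₊)
    (LipschitzWith.of_dist_le_mul fun f g => ?_)
  rw [dist_eq_norm, dist_eq_norm, ← VectorMeasure.integral_sub (hi f) (hi g),
    L1.norm_eq_integral_norm, integral_congr_ae (f := fun a => ‖(f - g) a‖) ((Lp.coeFn_sub f g).fun_comp norm)]
  refine VectorMeasure.norm_integral_le_integral_norm.trans
    (mul_le_mul_of_nonneg_left ?_ (norm_nonneg (ContinuousLinearMap.lsmul ℝ ℝ (E := ℂ))))
  exact integral_mono_measure h (Eventually.of_forall fun _ => norm_nonneg _)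
    ((L1.integrable_coeFn f).sub (L1.integrable_coeFn g)).norm

theorem continuous_integral_of_le' {μ M : Measure X} (h : μ ≤ M) :
    Continuous fun f : Lp ℝ 1 M => ∫ t, f t ∂μ := by
  have hi : ∀ f : Lp ℝ 1 M, Integrable f μ := fun f => (L1.integrable_coeFn f).mono_measure h
  refine LipschitzWith.continuous (K := 1) (LipschitzWith.of_dist_le_mul fun f g => ?_)
  rw [dist_eq_norm, dist_eq_norm, ← integral_sub (hi f) (hi g), NNReal.coe_one, one_mul,
    L1.norm_eq_integral_norm, integral_congr_ae (f := fun a => ‖(f - g) a‖) ((Lp.coeFn_sub f g).fun_comp norm)]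
  refine (norm_integral_le_integral_norm _).trans ?_
  exact integral_mono_measure h (Eventually.of_forall fun _ => norm_nonneg _)
    ((L1.integrable_coeFn f).sub (L1.integrable_coeFn g)).norm

/-- A complex measure which is a finite complex combination of finite positive measures has the
corresponding integrals. -/
theorem integral_eq_sum_of_apply_eq_sum {ι : Type*} [Fintype ι] {ν : ComplexMeasure X}
    {m : ι → Measure X} [∀ i, IsFiniteMeasure (m i)] {c : ι → ℂ}
    (h : ∀ E, MeasurableSet E → ν E = ∑ i, c i * ((m i).real E : ℂ))
    {f : X → ℝ} (hf : ∀ i, Integrable f (m i)) :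
    ν.Integrable f ∧ ∫ᵛ t, f t ∂•ν = ∑ i, c i * ((∫ t, f t ∂(m i) : ℝ) : ℂ) := by
  -- The weight `‖c i‖₊` makes `M` dominate the variation of `ν`; the extra 1 makes it dominate
  -- every `m i`, even where `c i` is small. Both sides are then continuous on L¹(M), and indicators
  -- suffice.
  let M : Measure X := ∑ i, (‖c i‖₊ + 1) • m i
  have hMapp : ∀ E, M E = ∑ i, ((‖c i‖₊ + 1 : NNReal) : ENNReal) * m i E := by
    intro E; simp [M, Measure.finsetSum_apply]
  have hM : IsFiniteMeasure M := by
    refine ⟨?_⟩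
    rw [hMapp]
    exact ENNReal.sum_lt_top.2 fun i _ => ENNReal.mul_lt_top ENNReal.coe_lt_top (measure_lt_top _ _)
  have hmM : ∀ i, m i ≤ M := fun i => Measure.le_iff.2 fun E _ => by
    rw [hMapp]
    refine le_trans ?_ (Finset.single_le_sum
      (f := fun i => ((‖c i‖₊ + 1 : NNReal) : ENNReal) * m i E) (fun _ _ => zero_le)
      (Finset.mem_univ i))
    refine le_mul_of_one_le_left zero_le ?_
    exact_mod_cast le_add_of_nonneg_left (zero_le (a := ‖c i‖₊))
  have hν : ν.variation ≤ M := by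
    refine VectorMeasure.variation_le_of_forall_enorm_le fun E hE => ?_
    rw [h E hE, hMapp]
    refine (enorm_sum_le _ _).trans (Finset.sum_le_sum fun i _ => ?_)
    rw [enorm_mul]
    refine mul_le_mul' ?_ ?_
    · rw [enorm_eq_nnnorm]
      exact_mod_cast le_add_of_nonneg_right (zero_le (a := (1 : NNReal)))
    · rw [← ofReal_norm, Complex.norm_real, Real.norm_of_nonneg measureReal_nonneg,
        ofReal_measureReal (measure_ne_top _ _)]
  have hfM : Integrable f M := by
    refine integrable_finsetSum_measure.2 fun i _ => ?_
    exact (hf i).smul_measure (by simp)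
  refine ⟨hfM.mono_measure hν, ?_⟩
  have hfin : IsFiniteMeasure ν.variation := isFiniteMeasure_of_le M hν
  refine Integrable.induction
    (P := fun f => ∫ᵛ t, f t ∂•ν = ∑ i, c i * ((∫ t, f t ∂(m i) : ℝ) : ℂ)) ?_ ?_ ?_ ?_ hfM
  · intro r E hE _
    rw [VectorMeasure.integral_indicator_const _ hE]
    simp [h E hE, integral_indicator_const, hE, mul_left_comm, mul_comm]
  · intro f g _ hf hg h1 h2
    rw [VectorMeasure.integral_add (hf.mono_measure hν) (hg.mono_measure hν), h1, h2,
      ← Finset.sum_add_distrib]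
    refine Finset.sum_congr rfl fun k _ => ?_
    rw [integral_add' (hf.mono_measure (hmM k)) (hg.mono_measure (hmM k))]
    push_cast; ring
  · refine isClosed_eq (continuous_integral_of_variation_le' hν) ?_
    exact continuous_finsetSum _ fun k _ => continuous_const.mul
      (Complex.continuous_ofReal.comp (continuous_integral_of_le' (hmM k)))
  · intro f g hfg _ h1
    have e1 : ∫ᵛ t, f t ∂•ν = ∫ᵛ t, g t ∂•ν :=
      VectorMeasure.integral_congr_ae (Measure.absolutelyContinuous_of_le hν hfg)
    have e2 : ∀ k, ∫ t, f t ∂(m k) = ∫ t, g t ∂(m k) := fun k =>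
      integral_congr_ae (Measure.absolutelyContinuous_of_le (hmM k) hfg)
    simpa only [e1, e2] using h1

theorem exists_complexMeasure_apply_eq_sum {ι : Type*} [Fintype ι] (m : ι → Measure X)
    [∀ i, IsFiniteMeasure (m i)] (c : ι → ℂ) :
    ∃ ν : ComplexMeasure X, ∀ E, MeasurableSet E → ν E = ∑ i, c i * ((m i).real E : ℂ) := by
  refine ⟨∑ i, c i • ((m i).toSignedMeasure.toComplexMeasure 0), fun E hE => ?_⟩
  have : ∀ s : Finset ι, (∑ i ∈ s, c i • ((m i).toSignedMeasure.toComplexMeasure 0)) E =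
      ∑ i ∈ s, c i * ((m i).real E : ℂ) := by
    classical
    intro s
    induction s using Finset.induction_on with
    | empty => simp
    | insert a s ha ih =>
      rw [Finset.sum_insert ha, Finset.sum_insert ha, ← ih, add_apply,
        smul_apply, SignedMeasure.toComplexMeasure_apply,
        Measure.toSignedMeasure_apply_measurable hE]
      simp [Complex.ext_iff]
  exact this _

end Combination

/-! ### Projection-valued measures and the powers of their operator -/

variable {H : Type*} [NormedAddCommGroup H] [InnerProductSpace ℂ H] [CompleteSpace H]

theorem inner_proj_eq_inner_proj_proj (P : PVM H) {E : Set ℝ} (hE : MeasurableSet E) (φ ψ : H) :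
    inner ℂ φ (P.proj E ψ) = inner ℂ (P.proj E φ) (P.proj E ψ) := by
  have hp := P.isStarProjection_proj E hE
  rw [← ContinuousLinearMap.adjoint_inner_right, ← ContinuousLinearMap.star_eq_adjoint,
    hp.isSelfAdjoint.star_eq, ← mul_apply_eq_comp, hp.isIdempotentElem.eq]

theorem inner_proj_left (P : PVM H) {E : Set ℝ} (hE : MeasurableSet E) (φ ψ : H) :
    inner ℂ (P.proj E φ) ψ = inner ℂ φ (P.proj E ψ) := by
  rw [← ContinuousLinearMap.adjoint_inner_right, ← ContinuousLinearMap.star_eq_adjoint,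
    (P.isStarProjection_proj E hE).isSelfAdjoint.star_eq]

theorem inner_proj_self (P : PVM H) {E : Set ℝ} (hE : MeasurableSet E) (z : H) :
    inner ℂ z (P.proj E z) = ((‖P.proj E z‖ ^ 2 : ℝ) : ℂ) := by
  rw [inner_proj_eq_inner_proj_proj P hE, inner_self_eq_norm_sq_to_K]
  simp

theorem hasSum_norm_sq_proj (P : PVM H) (z : H) {E : ℕ → Set ℝ} (hE : ∀ k, MeasurableSet (E k))
    (hd : Pairwise (Function.onFun Disjoint E)) :
    HasSum (fun k => ‖P.proj (E k) z‖ ^ 2) (‖P.proj (⋃ k, E k) z‖ ^ 2) := by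
  have h := (P.hasSum_proj E hE hd z).mapL (innerSL ℂ z)
  simp only [innerSL_apply_apply, inner_proj_self P (hE _),
    inner_proj_self P (MeasurableSet.iUnion hE)] at h
  exact_mod_cast h

/-- The positive measure `E ↦ ⟨z, P_E z⟩ = ‖P_E z‖²`. -/
def PVM.diag (P : PVM H) (z : H) : Measure ℝ :=
  Measure.ofMeasurable (fun E _ => ENNReal.ofReal (‖P.proj E z‖ ^ 2)) (by simp [P.proj_empty])
    (fun E hE hd => by
      have h := hasSum_norm_sq_proj P z hE hd
      rw [← h.tsum_eq, ENNReal.ofReal_tsum_of_nonneg (fun _ => by positivity) h.summable])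

theorem PVM.diag_apply (P : PVM H) (z : H) {E : Set ℝ} (hE : MeasurableSet E) :
    P.diag z E = ENNReal.ofReal (‖P.proj E z‖ ^ 2) :=
  Measure.ofMeasurable_apply E hE

instance (P : PVM H) (z : H) : IsFiniteMeasure (P.diag z) :=
  ⟨by rw [P.diag_apply z MeasurableSet.univ]; exact ENNReal.ofReal_lt_top⟩

theorem PVM.diag_real (P : PVM H) (z : H) {E : Set ℝ} (hE : MeasurableSet E) :
    (P.diag z).real E = ‖P.proj E z‖ ^ 2 := by
  rw [measureReal_def, P.diag_apply z hE, ENNReal.toReal_ofReal (by positivity)]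

theorem PVM.inner_proj (P : PVM H) (z : H) {E : Set ℝ} (hE : MeasurableSet E) :
    inner ℂ z (P.proj E z) = ((P.diag z).real E : ℂ) := by
  rw [P.diag_real z hE, inner_proj_self P hE]

/-- The positive measure of the vector P_E z carries its whole mass on E, so it vanishes on any F
disjoint from E. This yields multiplicativity of `P.proj` from σ-additivity alone. -/
theorem PVM.proj_mul_proj_of_disjoint (P : PVM H) {E F : Set ℝ} (hE : MeasurableSet E)
    (hF : MeasurableSet F) (h : Disjoint F E) : P.proj F * P.proj E = 0 := by
  ext z
  have e : P.proj E (P.proj E z) = P.proj E z := by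
    rw [← mul_apply_eq_comp, (P.isStarProjection_proj E hE).isIdempotentElem.eq]
  have h1 : (P.diag (P.proj E z)).real E = (P.diag (P.proj E z)).real Set.univ := by
    rw [P.diag_real _ hE, P.diag_real _ MeasurableSet.univ, e, P.proj_univ]; rfl
  have h2 := measureReal_mono (μ := P.diag (P.proj E z)) (Set.subset_univ (F ∪ E))
  rw [measureReal_union h hE, h1] at h2
  have h3 : (P.diag (P.proj E z)).real F = 0 := le_antisymm (by linarith) measureReal_nonneg
  rw [P.diag_real _ hF] at h3
  simpa using h3

theorem PVM.proj_union (P : PVM H) {E F : Set ℝ} (hE : MeasurableSet E)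
    (hF : MeasurableSet F) (h : Disjoint E F) : P.proj (E ∪ F) = P.proj E + P.proj F := by
  ext z
  refine ext_inner_left ℂ fun φ => ?_
  have := (P.complexMeasure φ z).of_union h hE hF
  rw [add_apply, inner_add_right]
  exact this

theorem PVM.proj_mul_proj (P : PVM H) {E F : Set ℝ} (hE : MeasurableSet E)
    (hF : MeasurableSet F) : P.proj F * P.proj E = P.proj (F ∩ E) := by
  have h1 : P.proj F = P.proj (F ∩ E) + P.proj (F \ E) := by
    rw [← P.proj_union (hF.inter hE) (hF.diff hE) (Set.disjoint_sdiff_inter.symm),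
      Set.inter_union_sdiff]
  have h2 : P.proj E + P.proj Eᶜ = 1 := by
    rw [← P.proj_union hE hE.compl disjoint_compl_right, Set.union_compl_self, P.proj_univ]
  have h3 : P.proj (F ∩ E) * P.proj Eᶜ = 0 := P.proj_mul_proj_of_disjoint hE.compl (hF.inter hE)
    (disjoint_compl_right.mono_left Set.inter_subset_right)
  rw [h1, add_mul, P.proj_mul_proj_of_disjoint hE (hF.diff hE) Set.disjoint_sdiff_left, add_zero,
    ← add_zero (P.proj (F ∩ E) * P.proj E), ← h3, ← mul_add, h2, mul_one]

theorem PVM.diag_proj (P : PVM H) {E : Set ℝ} (hE : MeasurableSet E) (z : H) :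
    P.diag (P.proj E z) = (P.diag z).restrict E := by
  ext F hF
  rw [Measure.restrict_apply hF, P.diag_apply _ hF, P.diag_apply _ (hF.inter hE),
    ← mul_apply_eq_comp, P.proj_mul_proj hE hF]

/-- The operator `X` is `∫ f dP` in the sense of quadratic forms. -/
def PVM.Represents (P : PVM H) (f : ℝ → ℝ) (X : H →L[ℂ] H) : Prop :=
  ∀ z : H, Integrable f (P.diag z) ∧ inner ℂ z (X z) = ((∫ t, f t ∂(P.diag z) : ℝ) : ℂ)

theorem PVM.represents_id {P : PVM H} {A : H →L[ℂ] H} (h : P.IsSpectralMeasureOf A) :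
    P.Represents (fun t => t) A := by
  intro z
  have hle : P.diag z ≤ (P.complexMeasure z z).variation := by
    refine Measure.le_iff.2 fun E hE => ?_
    refine le_trans (le_of_eq ?_) (VectorMeasure.enorm_measure_le_variation _ _)
    change _ = ‖inner ℂ z (P.proj E z)‖ₑ
    rw [inner_proj_self P hE, P.diag_apply z hE, ← ofReal_norm, Complex.norm_real,
      Real.norm_of_nonneg (by positivity)]
  have hi : Integrable (fun t : ℝ => t) (P.diag z) := (h z z).1.mono_measure hle
  refine ⟨hi, ?_⟩
  rw [(h z z).2, (integral_eq_sum_of_apply_eq_sum (ι := Unit) (m := fun _ => P.diag z)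
    (c := fun _ => 1) (fun E hE => ?_) (fun _ => hi)).2]
  · simp
  · rw [Fintype.sum_unique, one_mul]
    exact P.inner_proj z hE

/-- By multiplicativity, F ↦ ⟨P_E φ, P_F ψ⟩ and F ↦ ⟨φ, P_F P_E ψ⟩ are the same complex measure;
integrating the identity function against it gives the two matrix elements. -/
theorem PVM.comp_proj_eq_proj_comp {P : PVM H} {A : H →L[ℂ] H} (h : P.IsSpectralMeasureOf A)
    {E : Set ℝ} (hE : MeasurableSet E) : A * P.proj E = P.proj E * A := by
  ext ψ
  refine ext_inner_left ℂ fun φ => ?_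
  have e : P.complexMeasure (P.proj E φ) ψ = P.complexMeasure φ (P.proj E ψ) := by
    ext F hF
    change inner ℂ (P.proj E φ) (P.proj F ψ) = inner ℂ φ (P.proj F (P.proj E ψ))
    rw [inner_proj_left P hE, ← mul_apply_eq_comp, ← mul_apply_eq_comp, P.proj_mul_proj hE hF,
      P.proj_mul_proj hF hE, Set.inter_comm]
  rw [mul_apply_eq_comp, mul_apply_eq_comp, ← inner_proj_left P hE, (h _ _).2, (h _ _).2, e]

/-- For w = P_E z with E beyond ‖A‖, the number ⟨w, A w⟩ integrates values exceeding ‖A‖ in modulus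
against a measure of mass ‖w‖², which contradicts |⟨w, A w⟩| ≤ ‖A‖ ‖w‖² unless w = 0. Integrability
of all powers follows. -/
theorem PVM.ae_abs_le {P : PVM H} {A : H →L[ℂ] H} (h : P.IsSpectralMeasureOf A) (z : H) :
    ∀ᵐ t ∂(P.diag z), |t| ≤ ‖A‖ := by
  -- The sign `s = ±1` treats the two tails at once.
  have key : ∀ E : Set ℝ, MeasurableSet E → ∀ s : ℝ, |s| = 1 → (∀ t ∈ E, ‖A‖ < s * t) →
      P.diag z E = 0 := by
    intro E hE s hs hlt
    obtain ⟨hi, hint⟩ := P.represents_id h (P.proj E z)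
    set w := P.proj E z
    have hdw : P.diag w = (P.diag z).restrict E := P.diag_proj hE z
    have hA : s * ∫ t, t ∂(P.diag w) ≤ ‖A‖ * ‖w‖ ^ 2 := by
      refine (le_abs_self _).trans ?_
      rw [abs_mul, hs, one_mul, ← Real.norm_eq_abs, ← Complex.norm_real, ← hint]
      refine (norm_inner_le_norm _ _).trans ?_
      have := A.le_opNorm w
      nlinarith [norm_nonneg w]
    have hw : ‖w‖ ^ 2 = (P.diag w).real Set.univ := by
      rw [P.diag_real _ MeasurableSet.univ, P.proj_univ]; rfl
    have hae : ∀ᵐ t ∂(P.diag w), ‖A‖ < s * t := by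
      rw [hdw]; exact (ae_restrict_iff' hE).2 (Eventually.of_forall hlt)
    have hi2 : Integrable (fun t => s * t - ‖A‖) (P.diag w) :=
      (hi.const_mul s).sub (integrable_const _)
    have hz : ∫ t, (s * t - ‖A‖) ∂(P.diag w) = 0 := by
      refine le_antisymm ?_ (integral_nonneg_of_ae ?_)
      · rw [integral_sub (hi.const_mul s) (integrable_const _), integral_const_mul]
        simp only [integral_const, smul_eq_mul]
        rw [← hw]; linarith
      · filter_upwards [hae] with t ht using (sub_pos.2 ht).le
    rw [integral_eq_zero_iff_of_nonneg_ae
      (by filter_upwards [hae] with t ht using (sub_pos.2 ht).le) hi2] at hz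
    have hF : ∀ᵐ t ∂(P.diag w), False := by
      filter_upwards [hz, hae] with t h1 h2
      exact (sub_pos.2 h2).ne' h1
    rw [hdw, ae_iff] at hF
    simpa using hF
  have h1 := key {t | ‖A‖ < t} measurableSet_Ioi 1 (by simp) (fun t ht => by simpa using ht)
  have h2 := key {t | t < -‖A‖} measurableSet_Iio (-1) (by simp) (fun t ht => by
    have : t < -‖A‖ := ht
    linarith)
  filter_upwards [measure_eq_zero_iff_ae_notMem.1 h1, measure_eq_zero_iff_ae_notMem.1 h2] with t a b
  exact abs_le.2 ⟨not_lt.1 b, not_lt.1 a⟩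

/-- The vectors of the polarization identity. -/
def polarVec (φ ψ : H) : Fin 4 → H :=
  ![φ + ψ, φ - ψ, φ + Complex.I • ψ, φ - Complex.I • ψ]

/-- The coefficients of the polarization identity. -/
def polarCoeff : Fin 4 → ℂ := fun k => ![1, -1, -Complex.I, Complex.I] k / 4

/-- Polarization in this form needs no selfadjointness, so it applies to the unspecified operators
`X l`, `Y l` of `diagonalFunctionals`. -/
theorem inner_eq_polar {V : Type*} [NormedAddCommGroup V] [InnerProductSpace ℂ V] (T : V →L[ℂ] V)
    (φ ψ : V) :
    inner ℂ φ (T ψ) = ∑ k, polarCoeff k * inner ℂ (polarVec φ ψ k) (T (polarVec φ ψ k)) := by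
  simp only [Fin.sum_univ_four, polarCoeff, polarVec, Matrix.cons_val, map_add, map_sub, map_smul,
    inner_add_left, inner_add_right, inner_sub_left, inner_sub_right, inner_smul_left,
    inner_smul_right, Complex.conj_I]
  ring_nf
  simp only [Complex.I_sq]
  ring

/-- Induction on the power: the complex measure E ↦ ⟨z, P_E A z⟩ is computed in two ways, by
polarization and as t times the diagonal measure of z. Integrating t^k gives ⟨z, A^k A z⟩ on one
side and ∫ t^{k+1} on the other. -/
theorem PVM.represents_pow {P : PVM H} {A : H →L[ℂ] H} (h : P.IsSpectralMeasureOf A) (k : ℕ) :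
    P.Represents (fun t => t ^ k) (A ^ k) := by
  have hint : ∀ k z, Integrable (fun t : ℝ => t ^ k) (P.diag z) := by
    intro k z
    refine Integrable.of_bound (by fun_prop) (‖A‖ ^ k) ?_
    filter_upwards [P.ae_abs_le h z] with t ht
    rw [norm_pow]
    exact pow_le_pow_left₀ (norm_nonneg _) ht k
  refine fun z => ⟨hint k z, ?_⟩
  induction k generalizing z with
  | zero => simp [P.diag_real _ MeasurableSet.univ, P.proj_univ, inner_self_eq_norm_sq_to_K]
  | succ k ih =>
    -- The signed density t is split into t⁺ and t⁻, because `ENNReal.ofReal` cuts off negative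
    -- values.
    let m : Fin 2 → Measure ℝ := fun i => (P.diag z).withDensity
      fun t => ENNReal.ofReal (![t, -t] i)
    have hmeas : ∀ i : Fin 2, Measurable fun t : ℝ => ENNReal.ofReal (![t, -t] i) := by
      intro i; fin_cases i <;> simp <;> fun_prop
    have hid : ∀ i : Fin 2, Integrable (fun t : ℝ => ![t, -t] i) (P.diag z) := by
      have := (P.represents_id h z).1
      intro i; fin_cases i
      · simpa using this
      · exact Integrable.neg this
    have : ∀ i, IsFiniteMeasure (m i) := fun i => isFiniteMeasure_withDensity_ofReal (hid i).2
    have h1 : ∀ E, MeasurableSet E → P.complexMeasure z (A z) E =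
        ∑ i : Fin 2, ![1, -1] i * ((m i).real E : ℂ) := by
      intro E hE
      change inner ℂ z (P.proj E (A z)) = _
      have hp := (P.isStarProjection_proj E hE).isIdempotentElem.eq
      have e1 : inner ℂ z (P.proj E (A z)) = inner ℂ (P.proj E z) (A (P.proj E z)) := by
        rw [inner_proj_left P hE, ← mul_apply_eq_comp A, P.comp_proj_eq_proj_comp h hE,
          mul_apply_eq_comp, ← mul_apply_eq_comp (P.proj E) (P.proj E), hp]
      have e2 : ∀ i, (m i).real E = (∫⁻ t in E, ENNReal.ofReal (![t, -t] i) ∂(P.diag z)).toReal := by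
        intro i
        rw [measureReal_def, withDensity_apply _ hE]
      rw [e1, (P.represents_id h _).2, P.diag_proj hE, Fin.sum_univ_two, e2, e2,
        integral_eq_lintegral_pos_part_sub_lintegral_neg_part
          ((P.represents_id h z).1.mono_measure Measure.restrict_le_self)]
      simp [sub_eq_add_neg]
    have h2 : ∀ E, MeasurableSet E → P.complexMeasure z (A z) E =
        ∑ i, polarCoeff i * ((P.diag (polarVec z (A z) i)).real E : ℂ) := by
      intro E hE
      change inner ℂ z (P.proj E (A z)) = _
      rw [inner_eq_polar]
      simp only [P.inner_proj _ hE]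
    have i1 : ∀ i, Integrable (fun t : ℝ => t ^ k) (m i) := by
      intro i
      refine Integrable.of_bound (by fun_prop) (‖A‖ ^ k) ?_
      refine (withDensity_absolutelyContinuous _ _).ae_le ?_
      filter_upwards [P.ae_abs_le h z] with t ht
      rw [norm_pow]
      exact pow_le_pow_left₀ (norm_nonneg _) ht k
    have r1 := (integral_eq_sum_of_apply_eq_sum h1 i1).2
    have r2 := (integral_eq_sum_of_apply_eq_sum h2 (fun i => hint k _)).2
    have e3 : ∀ i, ∫ t, t ^ k ∂(m i) = ∫ t, max (![t, -t] i) 0 * t ^ k ∂(P.diag z) := by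
      intro i
      rw [integral_withDensity_eq_integral_toReal_smul (hmeas i)
        (Eventually.of_forall fun _ => ENNReal.ofReal_lt_top)]
      simp only [ENNReal.toReal_ofReal', smul_eq_mul]
    have i2 : ∀ i : Fin 2, Integrable (fun t : ℝ => max (![t, -t] i) 0 * t ^ k) (P.diag z) := by
      intro i
      refine ((hint (k + 1) z).norm).mono' ?_ ?_
      · fin_cases i <;> simp <;> fun_prop
      · refine Eventually.of_forall fun t => ?_
        rw [norm_mul, norm_pow, norm_pow, pow_succ']
        gcongr
        rw [Real.norm_eq_abs, Real.norm_eq_abs, abs_of_nonneg (le_max_right _ _)]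
        fin_cases i <;> simp [le_abs_self, neg_le_abs]
    rw [pow_succ, mul_apply_eq_comp, inner_eq_polar]
    simp only [ih]
    rw [← r2, r1, Fin.sum_univ_two, e3, e3]
    simp only [Matrix.cons_val_zero, Matrix.cons_val_one, one_mul, neg_mul, ← sub_eq_add_neg]
    rw [← Complex.ofReal_sub]
    have i20 := i2 0
    have i21 := i2 1
    simp only [Matrix.cons_val_zero, Matrix.cons_val_one] at i20 i21
    rw [← integral_sub i20 i21]
    congr 2
    ext t
    rw [← sub_mul, pow_succ']
    congr 1
    rcases le_total 0 t with ht | ht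
    · simp [ht]
    · simp [ht]

end RegularizedIntegral
end

/-! ### Regularized measures and their integrals -/

noncomputable section

namespace RegularizedIntegral

variable {H : Type*} [NormedAddCommGroup H] [InnerProductSpace ℂ H]

/-- The product `X₁ R Y₁ R X₂ R Y₂ R ⋯ R X_N R Y_N`. -/
def alternatingProduct (R : H →L[ℂ] H) {N : ℕ} (X Y : Fin N → H →L[ℂ] H) : H →L[ℂ] H :=
  ((List.ofFn fun l => X l * R * Y l).intersperse R).prod

theorem alternatingProduct_one (R : H →L[ℂ] H) (X Y : Fin 1 → H →L[ℂ] H) :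
    alternatingProduct R X Y = X 0 * R * Y 0 := by
  simp [alternatingProduct]

theorem alternatingProduct_succ (R : H →L[ℂ] H) {N : ℕ} (X Y : Fin (N + 2) → H →L[ℂ] H) :
    alternatingProduct R X Y =
      X 0 * R * Y 0 * (R * alternatingProduct R (Fin.tail X) (Fin.tail Y)) := by
  simp [alternatingProduct, List.ofFn_succ, Fin.tail, mul_assoc]

variable (H) in
/-- The span of the functionals `(X, Y) ↦ ∏ₗ ⟨aₗ, Xₗ aₗ⟩ ⟨bₗ, Yₗ bₗ⟩`. -/
def diagonalFunctionals (N : ℕ) :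
    Submodule ℂ ((Fin N → H →L[ℂ] H) → (Fin N → H →L[ℂ] H) → ℂ) :=
  Submodule.span ℂ (Set.range fun ab : (Fin N → H) × (Fin N → H) => fun X Y =>
    ∏ l, inner ℂ (ab.1 l) (X l (ab.1 l)) * inner ℂ (ab.2 l) (Y l (ab.2 l)))

/-- Polarizing the two new factors separately writes them as a double sum of diagonal ones, which
are prepended to the vectors of `G`. -/
theorem mul_tail_mem_diagonalFunctionals {N : ℕ}
    {G : (Fin N → H →L[ℂ] H) → (Fin N → H →L[ℂ] H) → ℂ} (hG : G ∈ diagonalFunctionals H N)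
    (u v u' v' : H) :
    (fun X Y : Fin (N + 1) → H →L[ℂ] H => inner ℂ u (X 0 v) * inner ℂ u' (Y 0 v') *
      G (Fin.tail X) (Fin.tail Y)) ∈ diagonalFunctionals H (N + 1) := by
  induction hG using Submodule.span_induction with
  | mem G hG =>
    obtain ⟨⟨a, b⟩, rfl⟩ := hG
    have e : (fun X Y : Fin (N + 1) → H →L[ℂ] H => inner ℂ u (X 0 v) * inner ℂ u' (Y 0 v') *
        ∏ l, inner ℂ (a l) (Fin.tail X l (a l)) * inner ℂ (b l) (Fin.tail Y l (b l))) =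
        ∑ i, ∑ j, (polarCoeff i * polarCoeff j) • fun X Y : Fin (N + 1) → H →L[ℂ] H =>
          ∏ l, inner ℂ ((Fin.cons (polarVec u v i) a : Fin (N + 1) → H) l)
            (X l ((Fin.cons (polarVec u v i) a : Fin (N + 1) → H) l)) *
          inner ℂ ((Fin.cons (polarVec u' v' j) b : Fin (N + 1) → H) l)
            (Y l ((Fin.cons (polarVec u' v' j) b : Fin (N + 1) → H) l)) := by
      ext X Y
      simp only [Finset.sum_apply, Pi.smul_apply, Fin.prod_univ_succ, Fin.cons_zero, Fin.cons_succ,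
        Fin.tail, smul_eq_mul]
      rw [inner_eq_polar (X 0), inner_eq_polar (Y 0), Finset.sum_mul_sum, Finset.sum_mul]
      refine Finset.sum_congr rfl fun i _ => ?_
      rw [Finset.sum_mul]
      refine Finset.sum_congr rfl fun j _ => ?_
      ring
    simp only
    rw [e]
    exact Submodule.sum_mem _ fun i _ => Submodule.sum_mem _ fun j _ =>
      Submodule.smul_mem _ _ (Submodule.subset_span ⟨(_, _), rfl⟩)
  | zero => simp only [Pi.zero_apply, mul_zero]; exact Submodule.zero_mem _
  | add G G' _ _ h h' =>
    convert Submodule.add_mem _ h h' using 1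
    ext X Y; simp [mul_add]
  | smul c G _ h =>
    convert Submodule.smul_mem _ c h using 1
    ext X Y; simp only [Pi.smul_apply, smul_eq_mul]; ring

section Complete

variable [CompleteSpace H]

/-- The vectors are an orthonormal basis of the range of `R`; finite rank makes the sum finite. -/
theorem exists_sum_inner_eq_inner {R : H →L[ℂ] H} (hR : IsStarProjection R)
    [FiniteDimensional ℂ (LinearMap.range (R : H →ₗ[ℂ] H))] :
    ∃ (d : ℕ) (e : Fin d → H), ∀ x y, inner ℂ x (R y) = ∑ k, inner ℂ x (e k) * inner ℂ (e k) y := by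
  let V := LinearMap.range (R : H →ₗ[ℂ] H)
  let b := stdOrthonormalBasis ℂ V
  have hidem : ∀ y, R (R y) = R y := fun y => by
    rw [← mul_apply_eq_comp, hR.isIdempotentElem.eq]
  have hs : ∀ x y, inner ℂ (R x) y = inner ℂ x (R y) := by
    intro x y
    rw [← ContinuousLinearMap.adjoint_inner_right, ← ContinuousLinearMap.star_eq_adjoint,
      hR.isSelfAdjoint.star_eq]
  refine ⟨_, fun k => (b k : H), fun x y => ?_⟩
  have hb : ∀ k, R (b k) = b k := by
    intro k
    obtain ⟨w, hw⟩ := (b k).2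
    rw [← hw]
    exact hidem w
  have h := b.sum_inner_mul_inner (⟨R x, x, rfl⟩ : V) (⟨R y, y, rfl⟩ : V)
  simp only [Submodule.coe_inner, hs, hb, hidem] at h
  rw [← h]
  refine Finset.sum_congr rfl fun k _ => ?_
  rw [← hs (b k) y, hb]

/-- Expanding every `R` over a basis of its range cuts the product into matrix elements of single
factors. Treating it as a functional of all `X`, `Y` lets one expansion serve both for spectral
projections and for the operators they integrate to. -/
theorem inner_alternatingProduct_mem {R : H →L[ℂ] H} (hR : IsStarProjection R)
    [FiniteDimensional ℂ (LinearMap.range (R : H →ₗ[ℂ] H))] (N : ℕ) (φ ψ : H) :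
    (fun X Y : Fin (N + 1) → H →L[ℂ] H => inner ℂ φ (alternatingProduct R X Y ψ)) ∈
      diagonalFunctionals H (N + 1) := by
  obtain ⟨d, e, he⟩ := exists_sum_inner_eq_inner hR
  have hX : ∀ (X : H →L[ℂ] H) (x y : H),
      inner ℂ x (X (R y)) = ∑ k, inner ℂ x (X (e k)) * inner ℂ (e k) y := by
    intro X x y
    rw [← ContinuousLinearMap.adjoint_inner_left, he]
    simp only [ContinuousLinearMap.adjoint_inner_left]
  induction N generalizing φ with
  | zero =>
    have h1 : (fun _ _ => 1) ∈ diagonalFunctionals H 0 :=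
      Submodule.subset_span ⟨(0, 0), by ext; simp⟩
    have : (fun X Y : Fin (0 + 1) → H →L[ℂ] H => inner ℂ φ (alternatingProduct R X Y ψ)) =
        ∑ k, fun X Y : Fin (0 + 1) → H →L[ℂ] H =>
          inner ℂ φ (X 0 (e k)) * inner ℂ (e k) (Y 0 ψ) * 1 := by
      ext X Y
      simp only [Finset.sum_apply, mul_one]
      rw [alternatingProduct_one, mul_apply_eq_comp, mul_apply_eq_comp, hX]
    rw [this]
    exact Submodule.sum_mem _ fun k _ => mul_tail_mem_diagonalFunctionals h1 _ _ _ _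
  | succ N ih =>
    have : (fun X Y : Fin (N + 1 + 1) → H →L[ℂ] H => inner ℂ φ (alternatingProduct R X Y ψ)) =
        ∑ k, ∑ j, fun X Y : Fin (N + 1 + 1) → H →L[ℂ] H =>
          inner ℂ φ (X 0 (e k)) * inner ℂ (e k) (Y 0 (e j)) *
            inner ℂ (e j) (alternatingProduct R (Fin.tail X) (Fin.tail Y) ψ) := by
      ext X Y
      simp only [Finset.sum_apply]
      rw [alternatingProduct_succ]
      simp only [mul_apply_eq_comp, hX, Finset.mul_sum, mul_assoc]
    rw [this]
    exact Submodule.sum_mem _ fun k _ => Submodule.sum_mem _ fun j _ =>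
      mul_tail_mem_diagonalFunctionals (ih _) _ _ _ _

/-- The regularized measures exist; integrals of product functions are matrix elements of
alternating products. -/
theorem exists_isRegularizedMeasure (P₁ P₂ : PVM H) {R : H →L[ℂ] H} (hR : IsStarProjection R)
    [FiniteDimensional ℂ (LinearMap.range (R : H →ₗ[ℂ] H))] (N : ℕ) (φ ψ : H) :
    ∃ ν : ComplexMeasure (Fin (N + 1) → ℝ × ℝ), IsRegularizedMeasure P₁ P₂ R φ ψ ν ∧
      ∀ (f g : Fin (N + 1) → ℝ → ℝ) (X Y : Fin (N + 1) → H →L[ℂ] H),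
        (∀ l, P₁.Represents (f l) (X l)) → (∀ l, P₂.Represents (g l) (Y l)) →
        ν.Integrable (fun x => ∏ l, f l (x l).1 * g l (x l).2) ∧
        ∫ᵛ x, (∏ l, f l (x l).1 * g l (x l).2) ∂•ν = inner ℂ φ (alternatingProduct R X Y ψ) := by
  obtain ⟨c, hc⟩ := Finsupp.mem_span_range_iff_exists_finsupp.1
    (inner_alternatingProduct_mem hR N φ ψ)
  -- The same coefficients give the box values, with projections for `X`, `Y`, and the integrals,
  -- with represented operators for `X`, `Y`.
  have hc' : ∀ X Y : Fin (N + 1) → H →L[ℂ] H, inner ℂ φ (alternatingProduct R X Y ψ) =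
      ∑ i : c.support, c i * ∏ l, inner ℂ (i.1.1 l) (X l (i.1.1 l)) *
        inner ℂ (i.1.2 l) (Y l (i.1.2 l)) := by
    intro X Y
    have := congrFun (congrFun hc X) Y
    rw [← this, Finsupp.sum, ← Finset.sum_coe_sort]
    simp only [Finset.sum_apply, Pi.smul_apply, smul_eq_mul]
  let m : c.support → Measure (Fin (N + 1) → ℝ × ℝ) := fun i =>
    Measure.pi fun l => (P₁.diag (i.1.1 l)).prod (P₂.diag (i.1.2 l))
  obtain ⟨ν, hν⟩ := exists_complexMeasure_apply_eq_sum m fun i => c i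
  refine ⟨ν, fun I J hI hJ => ?_, fun f g X Y hf hg => ?_⟩
  · rw [hν _ (MeasurableSet.univ_pi fun l => (hI l).prod (hJ l))]
    refine Eq.trans ?_ (hc' (fun l => P₁.proj (I l)) (fun l => P₂.proj (J l))).symm
    refine Finset.sum_congr rfl fun i _ => ?_
    simp only [m, measureReal_def, Measure.pi_pi, Measure.prod_prod, ENNReal.toReal_prod,
      ENNReal.toReal_mul, P₁.inner_proj _ (hI _), P₂.inner_proj _ (hJ _)]
    push_cast
    rfl
  · have hint : ∀ i, Integrable (fun x : Fin (N + 1) → ℝ × ℝ => ∏ l, f l (x l).1 * g l (x l).2)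
        (m i) := fun i => Integrable.fintype_prod (f := fun l (y : ℝ × ℝ) => f l y.1 * g l y.2)
          fun l => (hf l _).1.mul_prod (hg l _).1
    obtain ⟨h1, h2⟩ := integral_eq_sum_of_apply_eq_sum hν hint
    refine ⟨h1, ?_⟩
    rw [h2, hc']
    refine Finset.sum_congr rfl fun i _ => ?_
    rw [integral_fintype_prod_eq_prod (fun l (y : ℝ × ℝ) => f l y.1 * g l y.2)]
    simp only [integral_prod_mul, (hf _ _).2, (hg _ _).2]
    push_cast
    rfl

/-! ### Uniqueness, linearity, and removal of the regularization -/

theorem IsRegularizedMeasure.eq {P₁ P₂ : PVM H} {R : H →L[ℂ] H} {φ ψ : H} {N : ℕ}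
    {ν ν' : ComplexMeasure (Fin N → ℝ × ℝ)} (h : IsRegularizedMeasure P₁ P₂ R φ ψ ν)
    (h' : IsRegularizedMeasure P₁ P₂ R φ ψ ν') : ν = ν' := by
  let D : Set (Set (ℝ × ℝ)) :=
    Set.image2 (fun s t => s ×ˢ t) {s | MeasurableSet s} {t | MeasurableSet t}
  have hD : MeasurableSpace.generateFrom D = (inferInstance : MeasurableSpace (ℝ × ℝ)) :=
    generateFrom_prod
  have hspan : IsCountablySpanning D :=
    isCountablySpanning_measurableSet.prod isCountablySpanning_measurableSet
  have hgen := generateFrom_pi_eq (ι := Fin N) (C := fun _ => D) fun _ => hspan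
  rw [hD] at hgen
  have hbox : ∀ s ∈ Set.univ.pi '' Set.univ.pi (fun _ : Fin N => D), ν s = ν' s := by
    rintro _ ⟨s, hs, rfl⟩
    choose I hI J hJ e using fun l => hs l (Set.mem_univ l)
    obtain rfl : (fun l => I l ×ˢ J l) = s := funext e
    exact (h I J hI hJ).trans (h' I J hI hJ).symm
  refine VectorMeasure.ext_of_generateFrom _ hbox hgen (IsPiSystem.pi fun _ => isPiSystem_prod) ?_
  refine hbox _ ⟨fun _ => Set.univ, fun l _ => ⟨Set.univ, by simp, Set.univ, by simp,
    Set.univ_prod_univ⟩, Set.pi_univ _⟩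

/-- The measures are determined by their values on boxes, so both operators have the same matrix
elements as limits of the same sequence. -/
theorem IsOperatorIntegral.eq {P₁ P₂ : PVM H} {Q : ℕ → H →L[ℂ] H} {N : ℕ}
    {F : (Fin N → ℝ × ℝ) → ℝ} {T T' : H →L[ℂ] H} (h : IsOperatorIntegral P₁ P₂ Q F T)
    (h' : IsOperatorIntegral P₁ P₂ Q F T') : T = T' := by
  ext ψ
  refine ext_inner_left ℂ fun φ => ?_
  obtain ⟨ν, h1, -, h3⟩ := h φ ψ
  obtain ⟨ν', h1', -, h3'⟩ := h' φ ψ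
  obtain rfl : ν = ν' := funext fun n => (h1 n).eq (h1' n)
  exact tendsto_nhds_unique h3 h3'

theorem IsOperatorIntegral.add {P₁ P₂ : PVM H} {Q : ℕ → H →L[ℂ] H} {N : ℕ}
    {F F' : (Fin N → ℝ × ℝ) → ℝ} {T T' : H →L[ℂ] H} (h : IsOperatorIntegral P₁ P₂ Q F T)
    (h' : IsOperatorIntegral P₁ P₂ Q F' T') :
    IsOperatorIntegral P₁ P₂ Q (F + F') (T + T') := by
  intro φ ψ
  obtain ⟨ν, h1, h2, h3⟩ := h φ ψ
  obtain ⟨ν', h1', h2', h3'⟩ := h' φ ψ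
  obtain rfl : ν = ν' := funext fun n => (h1 n).eq (h1' n)
  refine ⟨ν, h1, fun n => (h2 n).add (h2' n), ?_⟩
  simp only [VectorMeasure.integral_add (h2 _) (h2' _), add_apply, inner_add_right]
  exact h3.add h3'

theorem IsOperatorIntegral.smul {P₁ P₂ : PVM H} {Q : ℕ → H →L[ℂ] H} {N : ℕ}
    {F : (Fin N → ℝ × ℝ) → ℝ} {T : H →L[ℂ] H} (c : ℝ) (h : IsOperatorIntegral P₁ P₂ Q F T) :
    IsOperatorIntegral P₁ P₂ Q (c • F) (c • T) := by
  intro φ ψ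
  obtain ⟨ν, h1, h2, h3⟩ := h φ ψ
  refine ⟨ν, h1, fun n => Integrable.smul c (h2 n), ?_⟩
  simp only [VectorMeasure.integral_smul, smul_apply, inner_smul_right_eq_smul]
  exact h3.const_smul c

/-- Strong convergence passes through the product because ‖Q_n‖ ≤ 1: if u_n → v, then Q_n u_n → v.
-/
theorem tendsto_alternatingProduct {Q : ℕ → H →L[ℂ] H} (hQ : IsRegularizing Q) {N : ℕ}
    (X Y : Fin (N + 1) → H →L[ℂ] H) (ψ : H) :
    Tendsto (fun n => alternatingProduct (Q n) X Y ψ) atTop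
      (𝓝 ((List.ofFn fun l => X l * Y l).prod ψ)) := by
  have hQt : ∀ {u : ℕ → H} {v : H}, Tendsto u atTop (𝓝 v) →
      Tendsto (fun n => Q n (u n)) atTop (𝓝 v) := by
    intro u v hu
    have h1 : Tendsto (fun n => Q n (u n - v)) atTop (𝓝 0) := by
      refine squeeze_zero_norm (fun n => ?_) (tendsto_iff_norm_sub_tendsto_zero.1 hu)
      refine ((Q n).le_opNorm _).trans ?_
      exact mul_le_of_le_one_left (norm_nonneg _) (hQ.isStarProjection n).norm_le
    simpa using h1.add (hQ.tendsto v)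
  induction N generalizing ψ with
  | zero =>
    simp only [alternatingProduct_one, mul_apply_eq_comp]
    simpa [Function.comp_def] using ((X 0).continuous.tendsto _).comp (hQt tendsto_const_nhds)
  | succ N ih =>
    simp only [alternatingProduct_succ, mul_apply_eq_comp]
    rw [List.ofFn_succ, List.prod_cons, mul_apply_eq_comp, mul_apply_eq_comp]
    exact ((X 0).continuous.tendsto _).comp (hQt (((Y 0).continuous.tendsto _).comp
      (hQt (ih (Fin.tail X) (Fin.tail Y) ψ))))

/-- The span of the pairs of a monomial `∏ₗ λₗ^{kₗ} μₗ^{mₗ}` and its ordered product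
`∏ₗ A^{kₗ} B^{mₗ}`. -/
def orderedPairs (A B : H →L[ℂ] H) (N : ℕ) :
    Submodule ℝ (((Fin N → ℝ × ℝ) → ℝ) × (H →L[ℂ] H)) :=
  Submodule.span ℝ (Set.range fun km : (Fin N → ℕ) × (Fin N → ℕ) =>
    (fun x => ∏ l, (x l).1 ^ km.1 l * (x l).2 ^ km.2 l,
      (List.ofFn fun l => A ^ km.1 l * B ^ km.2 l).prod))

theorem isOperatorIntegral_of_mem_orderedPairs {A B : H →L[ℂ] H} {P₁ P₂ : PVM H}
    (h₁ : P₁.IsSpectralMeasureOf A) (h₂ : P₂.IsSpectralMeasureOf B) {Q : ℕ → H →L[ℂ] H}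
    (hQ : IsRegularizing Q) {N : ℕ} (hN : 1 ≤ N)
    {FT : ((Fin N → ℝ × ℝ) → ℝ) × (H →L[ℂ] H)} (hFT : FT ∈ orderedPairs A B N) :
    IsOperatorIntegral P₁ P₂ Q FT.1 FT.2 := by
  obtain ⟨N, rfl⟩ := Nat.exists_eq_add_of_le' hN
  have hmon : ∀ k m : Fin (N + 1) → ℕ, IsOperatorIntegral P₁ P₂ Q
      (fun x => ∏ l, (x l).1 ^ k l * (x l).2 ^ m l)
      (List.ofFn fun l => A ^ k l * B ^ m l).prod := by
    intro k m φ ψ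
    have hfin := hQ.finiteDimensional_range
    choose ν hν hint using fun n =>
      exists_isRegularizedMeasure P₁ P₂ (hQ.isStarProjection n) N φ ψ
    have hint' := fun n => hint n (fun l t => t ^ k l) (fun l t => t ^ m l) (fun l => A ^ k l)
      (fun l => B ^ m l) (fun l => PVM.represents_pow h₁ _) (fun l => PVM.represents_pow h₂ _)
    refine ⟨ν, hν, fun n => (hint' n).1, ?_⟩
    simp only [(hint' _).2]
    exact tendsto_const_nhds.inner (tendsto_alternatingProduct hQ _ _ ψ)
  induction hFT using Submodule.span_induction with
  | mem FT h =>
    obtain ⟨⟨k, m⟩, rfl⟩ := h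
    exact hmon k m
  -- The zero pair is 0 times the constant monomial, for which the measures are known to exist.
  | zero => simpa using (hmon 0 0).smul 0
  | add _ _ _ _ h h' => exact h.add h'
  | smul c _ _ h => exact h.smul c

theorem IsStrongLimitOfIntegrals.add {P₁ P₂ : PVM H} {F F' : (N : ℕ) → (Fin N → ℝ × ℝ) → ℝ}
    {X X' : H →L[ℂ] H} (h : IsStrongLimitOfIntegrals P₁ P₂ F X)
    (h' : IsStrongLimitOfIntegrals P₁ P₂ F' X') :
    IsStrongLimitOfIntegrals P₁ P₂ (fun N x => F N x + F' N x) (X + X') := by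
  obtain ⟨T, h1, h2⟩ := h
  obtain ⟨T', h1', h2'⟩ := h'
  refine ⟨fun N => T N + T' N, fun N hN Q hQ => ?_, fun ψ => (h2 ψ).add (h2' ψ)⟩
  have := (h1 N hN Q hQ).1.add (h1' N hN Q hQ).1
  exact ⟨this, fun _ hT => hT.eq this⟩

theorem IsStrongLimitOfIntegrals.const_mul {P₁ P₂ : PVM H} {F : (N : ℕ) → (Fin N → ℝ × ℝ) → ℝ}
    {X : H →L[ℂ] H} (c : ℝ) (h : IsStrongLimitOfIntegrals P₁ P₂ F X) :
    IsStrongLimitOfIntegrals P₁ P₂ (fun N x => c * F N x) (c • X) := by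
  obtain ⟨T, h1, h2⟩ := h
  refine ⟨fun N => c • T N, fun N hN Q hQ => ?_, fun ψ => (h2 ψ).const_smul c⟩
  have := (h1 N hN Q hQ).1.smul c
  exact ⟨this, fun _ hT => hT.eq this⟩

end Complete

end RegularizedIntegral
end

/-! ### Words in two noncommuting letters -/

noncomputable section

namespace RegularizedIntegral

section Words

variable {R : Type*} [Ring R]

/-- The sum of all words with `p` letters `A` and `n - p` letters `B`. -/
def wordSum (A B : R) (n p : ℕ) : R :=
  ((Polynomial.C A * Polynomial.X + Polynomial.C B) ^ n).coeff p

theorem wordSum_zero (A B : R) (p : ℕ) : wordSum A B 0 p = if p = 0 then 1 else 0 := by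
  simp [wordSum, Polynomial.coeff_one]

theorem wordSum_succ_zero (A B : R) (n : ℕ) :
    wordSum A B (n + 1) 0 = B * wordSum A B n 0 := by
  simp [wordSum, pow_succ', add_mul, mul_assoc, Polynomial.X_mul]

theorem wordSum_succ_succ (A B : R) (n p : ℕ) :
    wordSum A B (n + 1) (p + 1) = A * wordSum A B n p + B * wordSum A B n (p + 1) := by
  simp [wordSum, pow_succ', add_mul, mul_assoc, Polynomial.X_mul]

theorem wordSum_succ_zero' (A B : R) (n : ℕ) :
    wordSum A B (n + 1) 0 = wordSum A B n 0 * B := by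
  simp [wordSum, pow_succ, mul_add, ← mul_assoc]

theorem wordSum_succ_succ' (A B : R) (n p : ℕ) :
    wordSum A B (n + 1) (p + 1) = wordSum A B n p * A + wordSum A B n (p + 1) * B := by
  simp [wordSum, pow_succ, mul_add, ← mul_assoc]

theorem wordSum_eq_zero_of_lt (A B : R) {n p : ℕ} (h : n < p) : wordSum A B n p = 0 := by
  induction n generalizing p with
  | zero => rw [wordSum_zero, if_neg h.ne']
  | succ n ih =>
    obtain ⟨p, rfl⟩ := Nat.exists_eq_add_of_lt h
    rw [wordSum_succ_succ, ih (by omega), ih (by omega), mul_zero, mul_zero, add_zero]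

/-- The adjoint reverses words, exchanging the recursion on the first letter with the one on the
last. -/
theorem isSelfAdjoint_wordSum [StarRing R] {A B : R} (hA : IsSelfAdjoint A) (hB : IsSelfAdjoint B)
    (n p : ℕ) : IsSelfAdjoint (wordSum A B n p) := by
  induction n generalizing p with
  | zero =>
    rw [wordSum_zero]; split_ifs
    · exact IsSelfAdjoint.one R
    · exact IsSelfAdjoint.zero R
  | succ n ih =>
    cases p with
    | zero => rw [isSelfAdjoint_iff, wordSum_succ_zero, star_mul, (ih 0).star_eq, hB.star_eq,
        ← wordSum_succ_zero, wordSum_succ_zero']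
    | succ p => rw [isSelfAdjoint_iff, wordSum_succ_succ, star_add, star_mul, star_mul,
        (ih _).star_eq, (ih _).star_eq, hA.star_eq, hB.star_eq, ← wordSum_succ_succ,
        wordSum_succ_succ']

/-- The subsets split according to whether they contain position 0, that is, by the first letter of
the word. -/
theorem sum_words_eq_wordSum (A B : R) (n p : ℕ) :
    ∑ s ∈ Finset.powersetCard p (Finset.univ : Finset (Fin n)),
      (List.ofFn fun i => if i ∈ s then A else B).prod = wordSum A B n p := by
  have h0 : ∀ {n : ℕ} (t : Finset (Fin n)), (0 : Fin (n + 1)) ∉ t.map (Fin.succEmb n) := by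
    intro n t; simp [Fin.succ_ne_zero]
  have hB : ∀ {n : ℕ} (t : Finset (Fin n)), (List.ofFn fun i : Fin (n + 1) =>
      if i ∈ t.map (Fin.succEmb n) then A else B).prod =
      B * (List.ofFn fun i => if i ∈ t then A else B).prod := by
    intro n t
    rw [List.ofFn_succ, List.prod_cons, if_neg (h0 t)]
    simp
  have hA : ∀ {n : ℕ} (t : Finset (Fin n)), (List.ofFn fun i : Fin (n + 1) =>
      if i ∈ insert 0 (t.map (Fin.succEmb n)) then A else B).prod =
      A * (List.ofFn fun i => if i ∈ t then A else B).prod := by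
    intro n t
    rw [List.ofFn_succ, List.prod_cons, if_pos (Finset.mem_insert_self _ _)]
    simp [Fin.succ_ne_zero]
  have huniv : ∀ n : ℕ, (Finset.univ : Finset (Fin (n + 1))) =
      insert 0 (Finset.univ.map (Fin.succEmb n)) := by
    intro n; ext i; refine Fin.cases ?_ (fun i => ?_) i <;> simp
  induction n generalizing p with
  | zero =>
    rw [wordSum_zero]
    cases p <;> simp
  | succ n ih =>
    cases p with
    | zero =>
      rw [wordSum_succ_zero, ← ih 0]
      simp [List.ofFn_const]
    | succ p =>
      rw [wordSum_succ_succ, ← ih, ← ih, huniv, Finset.powersetCard_succ_insert (h0 _),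
        Finset.sum_union, add_comm, Finset.powersetCard_map, Finset.powersetCard_map,
        Finset.sum_image, Finset.sum_map, Finset.sum_map, Finset.mul_sum, Finset.mul_sum]
      · congr 1
        · exact Finset.sum_congr rfl fun t _ => hA t
        · exact Finset.sum_congr rfl fun t _ => hB t
      · intro s hs t ht hst
        simp only [Finset.coe_map, Set.mem_image] at hs ht
        obtain ⟨s, -, rfl⟩ := hs
        obtain ⟨t, -, rfl⟩ := ht
        have := congrArg (fun u => u.erase 0) hst
        exact (Finset.erase_insert (h0 s)).symm.trans (this.trans (Finset.erase_insert (h0 t)))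
      · rw [Finset.disjoint_left]
        intro s hs hs'
        obtain ⟨t, -, rfl⟩ := Finset.mem_image.1 hs'
        exact h0 _ ((Finset.mem_powersetCard.1 hs).1 (Finset.mem_insert_self _ _))

/-! ### The formal series exp(sA) exp(tB) and its powers -/

/-- The coefficient of `s^p t^q` in `f`. -/
def coeff₂ (p q : ℕ) (f : PowerSeries (PowerSeries R)) : R :=
  PowerSeries.coeff q (PowerSeries.coeff p f)

theorem coeff₂_mul (p q : ℕ) (f g : PowerSeries (PowerSeries R)) :
    coeff₂ p q (f * g) = ∑ x ∈ Finset.HasAntidiagonal.antidiagonal p,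
      ∑ y ∈ Finset.HasAntidiagonal.antidiagonal q,
      coeff₂ x.1 y.1 f * coeff₂ x.2 y.2 g := by
  simp [coeff₂, PowerSeries.coeff_mul]

theorem coeff₂_one (p q : ℕ) :
    coeff₂ p q (1 : PowerSeries (PowerSeries R)) = if p = 0 ∧ q = 0 then 1 else 0 := by
  by_cases hp : p = 0 <;> simp [coeff₂, PowerSeries.coeff_one, hp]

/-- The linear part of `exp (s A) exp (t B) - 1`. -/
def linearSeries (A B : R) : PowerSeries (PowerSeries R) :=
  PowerSeries.X * PowerSeries.C (PowerSeries.C A) +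
    PowerSeries.C (PowerSeries.X * PowerSeries.C B)

theorem coeff₂_linearSeries_mul (A B : R) (p q : ℕ) (g : PowerSeries (PowerSeries R)) :
    coeff₂ p q (linearSeries A B * g) = (if p = 0 then 0 else A * coeff₂ (p - 1) q g) +
      (if q = 0 then 0 else B * coeff₂ p (q - 1) g) := by
  rw [linearSeries, add_mul, mul_assoc]
  simp only [coeff₂, map_add, PowerSeries.coeff_C_mul, mul_assoc]
  congr 1
  · cases p <;> simp [PowerSeries.coeff_zero_X_mul, PowerSeries.coeff_succ_X_mul]
  · cases q <;> simp [PowerSeries.coeff_zero_X_mul, PowerSeries.coeff_succ_X_mul]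

theorem coeff₂_linearSeries (A B : R) (p q : ℕ) : coeff₂ p q (linearSeries A B) =
    if p = 1 ∧ q = 0 then A else if p = 0 ∧ q = 1 then B else 0 := by
  rw [← mul_one (linearSeries A B), coeff₂_linearSeries_mul, coeff₂_one, coeff₂_one]
  rcases p with _ | _ | p <;> rcases q with _ | _ | q <;> simp

variable [Algebra ℝ R]

/-- The coefficient `A^p B^q / (p! q!)` of `s^p t^q` in `exp (s A) exp (t B)`. -/
def expCoeff (A B : R) (p q : ℕ) : R :=
  ((p.factorial : ℝ)⁻¹ * (q.factorial : ℝ)⁻¹) • (A ^ p * B ^ q)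

/-- The formal power series `exp (s A) exp (t B)`. -/
def expSeries (A B : R) : PowerSeries (PowerSeries R) :=
  PowerSeries.mk fun p => PowerSeries.mk fun q => expCoeff A B p q

theorem coeff₂_expSeries (A B : R) (p q : ℕ) : coeff₂ p q (expSeries A B) = expCoeff A B p q := by
  simp [coeff₂, expSeries]

theorem coeff₂_expSeries_sub {A B : R} {p q : ℕ} (h : p + q ≤ 1) :
    coeff₂ p q (expSeries A B - 1 - linearSeries A B) = 0 := by
  have : coeff₂ p q (expSeries A B - 1 - linearSeries A B) = coeff₂ p q (expSeries A B) -
      coeff₂ p q 1 - coeff₂ p q (linearSeries A B) := by simp [coeff₂]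
  rw [this, coeff₂_expSeries, coeff₂_one, coeff₂_linearSeries]
  have : (p = 0 ∧ q = 0) ∨ (p = 1 ∧ q = 0) ∨ (p = 0 ∧ q = 1) := by omega
  rcases this with ⟨rfl, rfl⟩ | ⟨rfl, rfl⟩ | ⟨rfl, rfl⟩ <;> simp [expCoeff]

/-- The series E - 1 starts in degree 1 with sA + tB, so its j-th power starts in degree j with (sA
+ tB)^j. -/
theorem coeff₂_expSeries_sub_one_pow (A B : R) (j : ℕ) {p q : ℕ} :
    (p + q < j → coeff₂ p q ((expSeries A B - 1) ^ j) = 0) ∧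
    (p + q = j → coeff₂ p q ((expSeries A B - 1) ^ j) = wordSum A B j p) := by
  induction j generalizing p q with
  | zero =>
    refine ⟨by omega, fun h => ?_⟩
    obtain ⟨rfl, rfl⟩ : p = 0 ∧ q = 0 := by omega
    rw [pow_zero, coeff₂_one, wordSum_zero]; simp
  | succ j ih =>
    -- Up to degree j + 1 one factor may be replaced by its linear part: the remainder starts in
    -- degree 2 and the other j factors together in degree j.
    have key : p + q ≤ j + 1 → coeff₂ p q ((expSeries A B - 1) ^ (j + 1)) =
        coeff₂ p q (linearSeries A B * (expSeries A B - 1) ^ j) := by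
      intro h
      have e : (expSeries A B - 1) ^ (j + 1) = linearSeries A B * (expSeries A B - 1) ^ j +
          (expSeries A B - 1 - linearSeries A B) * (expSeries A B - 1) ^ j := by
        rw [pow_succ', ← add_mul, add_sub_cancel]
      have e2 : coeff₂ p q
          ((expSeries A B - 1 - linearSeries A B) * (expSeries A B - 1) ^ j) = 0 := by
        rw [coeff₂_mul]
        refine Finset.sum_eq_zero fun x hx => Finset.sum_eq_zero fun y hy => ?_
        have hx := Finset.HasAntidiagonal.mem_antidiagonal.1 hx
        have hy := Finset.HasAntidiagonal.mem_antidiagonal.1 hy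
        by_cases hxy : x.1 + y.1 ≤ 1
        · rw [coeff₂_expSeries_sub hxy, zero_mul]
        · rw [ih.1 (by omega), mul_zero]
      rw [e, coeff₂, map_add, map_add]
      change coeff₂ p q _ + coeff₂ p q _ = _
      rw [e2, add_zero]
    constructor
    · intro h
      rw [key h.le, coeff₂_linearSeries_mul]
      have h1 : p ≠ 0 → coeff₂ (p - 1) q ((expSeries A B - 1) ^ j) = 0 :=
        fun hp => ih.1 (by omega)
      have h2 : q ≠ 0 → coeff₂ p (q - 1) ((expSeries A B - 1) ^ j) = 0 :=
        fun hq => ih.1 (by omega)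
      split_ifs with hp hq hq
      · rw [add_zero]
      · rw [h2 hq, mul_zero, add_zero]
      · rw [h1 hp, mul_zero, add_zero]
      · rw [h1 hp, h2 hq, mul_zero, mul_zero, add_zero]
    · intro h
      rw [key h.le, coeff₂_linearSeries_mul]
      rcases p with _ | p
      · rw [if_pos rfl, if_neg (by omega), ih.2 (by omega), wordSum_succ_zero, zero_add]
      · rw [if_neg (by omega), wordSum_succ_succ, Nat.add_sub_cancel, ih.2 (by omega)]
        by_cases hq : q = 0
        · rw [if_pos hq, wordSum_eq_zero_of_lt A B (by omega : j < p + 1), mul_zero]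
        · rw [if_neg hq, ih.2 (by omega)]

/-- Binomial expansion of (1 + (E - 1))^N, with a range of summation that no longer depends on N. -/
theorem coeff₂_expSeries_pow (A B : R) (N p q : ℕ) : coeff₂ p q (expSeries A B ^ N) =
    ∑ j ∈ Finset.range (p + q + 1), (N.choose j : ℝ) • coeff₂ p q ((expSeries A B - 1) ^ j) := by
  have h1 : expSeries A B ^ N =
      ∑ j ∈ Finset.range (N + 1), N.choose j • (expSeries A B - 1) ^ j := by
    conv_lhs => rw [← sub_add_cancel (expSeries A B) 1, (Commute.one_right _).add_pow]
    refine Finset.sum_congr rfl fun j _ => ?_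
    rw [one_pow, mul_one, nsmul_eq_mul, Nat.cast_comm]
  have h2 : coeff₂ p q (expSeries A B ^ N) =
      ∑ j ∈ Finset.range (N + 1), (N.choose j : ℝ) • coeff₂ p q ((expSeries A B - 1) ^ j) := by
    rw [h1, coeff₂, map_sum, map_sum]
    refine Finset.sum_congr rfl fun j _ => ?_
    rw [map_nsmul, map_nsmul, Nat.cast_smul_eq_nsmul]
    rfl
  rw [h2]
  -- Both ranges are extended to their maximum: beyond `N` the binomial coefficient vanishes, beyond
  -- `p + q` the coefficient of the power does.
  have hle1 := Finset.range_mono (Nat.le_max_left (N + 1) (p + q + 1))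
  have hle2 := Finset.range_mono (Nat.le_max_right (N + 1) (p + q + 1))
  rw [Finset.sum_subset hle1, Finset.sum_subset hle2]
  · intro j _ hj
    rw [(coeff₂_expSeries_sub_one_pow A B j).1 (by simpa using hj), smul_zero]
  · intro j _ hj
    rw [Nat.choose_eq_zero_of_lt (by simpa using hj), Nat.cast_zero, zero_smul]

theorem tendsto_choose_div_pow (j : ℕ) :
    Tendsto (fun N : ℕ => (N.choose j : ℝ) / (N : ℝ) ^ j) atTop (𝓝 (j.factorial : ℝ)⁻¹) := by
  have hz : ∀ᶠ N : ℕ in atTop, ((N : ℝ) ^ j / j.factorial) ≠ 0 := by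
    filter_upwards [eventually_ne_atTop 0] with N hN
    positivity
  have h := ((Asymptotics.isEquivalent_iff_tendsto_one hz).1 (isEquivalent_choose j)).mul_const
    (j.factorial : ℝ)⁻¹
  rw [one_mul] at h
  refine h.congr' ?_
  filter_upwards [eventually_ne_atTop 0] with N hN
  have : (N : ℝ) ≠ 0 := by exact_mod_cast hN
  simp only [Pi.div_apply]
  field_simp

theorem tendsto_choose_div_pow_of_lt {j k : ℕ} (h : j < k) :
    Tendsto (fun N : ℕ => (N.choose j : ℝ) / (N : ℝ) ^ k) atTop (𝓝 0) := by
  have h1 : Tendsto (fun N : ℕ => ((N : ℝ) ^ (k - j))⁻¹) atTop (𝓝 0) :=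
    tendsto_inv_atTop_zero.comp ((tendsto_pow_atTop (by omega)).comp tendsto_natCast_atTop_atTop)
  have := (tendsto_choose_div_pow j).mul h1
  rw [mul_zero] at this
  refine this.congr fun N => ?_
  rw [← div_eq_mul_inv, div_div, ← pow_add, Nat.add_sub_cancel' h.le]

end Words
end RegularizedIntegral
end

/-! ### The limit of many factors and the conclusion -/

noncomputable section

namespace RegularizedIntegral

/-- Since C(N,j) grows like N^j / j!, only the top term j = p + q survives the division; the factor
p! q! / (p+q)! is the inverse binomial coefficient. -/
theorem tendsto_smul_coeff₂_expSeries_pow {R : Type*} [Ring R] [Algebra ℝ R]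
    [TopologicalSpace R] [ContinuousAdd R] [ContinuousSMul ℝ R] (A B : R) (p q : ℕ) :
    Tendsto (fun N : ℕ => ((p.factorial : ℝ) * q.factorial / (N : ℝ) ^ (p + q)) •
        coeff₂ p q (expSeries A B ^ N)) atTop
      (𝓝 (((p + q).choose q : ℝ)⁻¹ • wordSum A B (p + q) p)) := by
  have h1 : ∀ j ∈ Finset.range (p + q + 1), Tendsto (fun N : ℕ =>
      ((p.factorial : ℝ) * q.factorial * ((N.choose j : ℝ) / (N : ℝ) ^ (p + q))) •
        coeff₂ p q ((expSeries A B - 1) ^ j)) atTop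
      (𝓝 (if j = p + q then ((p + q).choose q : ℝ)⁻¹ • wordSum A B (p + q) p else 0)) := by
    intro j hj
    split_ifs with hjk
    · subst hjk
      rw [← (coeff₂_expSeries_sub_one_pow A B (p + q)).2 rfl]
      refine Tendsto.smul_const ?_ _
      have := (tendsto_choose_div_pow (p + q)).const_mul ((p.factorial : ℝ) * q.factorial)
      convert this using 2
      rw [← Nat.add_choose_mul_factorial_mul_factorial p q]
      push_cast
      have := Nat.factorial_ne_zero p
      have := Nat.factorial_ne_zero q
      have := (Nat.choose_pos (Nat.le_add_left q p)).ne'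
      field_simp
    · have hlt : j < p + q := by
        have := Finset.mem_range.1 hj
        omega
      have := ((tendsto_choose_div_pow_of_lt hlt).const_mul
        ((p.factorial : ℝ) * q.factorial)).smul_const (coeff₂ p q ((expSeries A B - 1) ^ j))
      simpa using this
  have h2 := tendsto_finsetSum _ h1
  rw [Finset.sum_ite_eq', if_pos (Finset.self_mem_range_succ _)] at h2
  refine h2.congr fun N => ?_
  rw [coeff₂_expSeries_pow, Finset.smul_sum]
  refine Finset.sum_congr rfl fun j _ => ?_
  rw [smul_smul]
  congr 1
  ring

/-- In divided powers the binomial theorem is a Cauchy product without coefficients, matching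
multiplication of power series. -/
theorem inv_factorial_mul_add_pow (a b : ℝ) (p : ℕ) :
    (p.factorial : ℝ)⁻¹ * (a + b) ^ p = ∑ x ∈ Finset.HasAntidiagonal.antidiagonal p,
      ((x.1.factorial : ℝ)⁻¹ * a ^ x.1) * ((x.2.factorial : ℝ)⁻¹ * b ^ x.2) := by
  rw [(Commute.all a b).add_pow', Finset.mul_sum]
  refine Finset.sum_congr rfl fun x hx => ?_
  obtain rfl := Finset.HasAntidiagonal.mem_antidiagonal.1 hx
  rw [← Nat.add_choose_mul_factorial_mul_factorial x.1 x.2, nsmul_eq_mul,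
    Nat.choose_symm_add]
  push_cast
  have := Nat.factorial_ne_zero x.1
  have := Nat.factorial_ne_zero x.2
  have := (Nat.choose_pos (Nat.le_add_left x.2 x.1)).ne'
  field_simp

variable {H : Type*} [NormedAddCommGroup H] [InnerProductSpace ℂ H]

theorem cons_mem_orderedPairs {A B : H →L[ℂ] H} {N : ℕ}
    {FT : ((Fin N → ℝ × ℝ) → ℝ) × (H →L[ℂ] H)} (h : FT ∈ orderedPairs A B N) (a b : ℕ) :
    ((fun x : Fin (N + 1) → ℝ × ℝ => (x 0).1 ^ a * (x 0).2 ^ b * FT.1 (Fin.tail x)),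
      A ^ a * B ^ b * FT.2) ∈ orderedPairs A B (N + 1) := by
  induction h using Submodule.span_induction with
  | mem FT h =>
    obtain ⟨⟨k, m⟩, rfl⟩ := h
    refine Submodule.subset_span ⟨(Fin.cons a k, Fin.cons b m), ?_⟩
    refine Prod.ext ?_ ?_
    · ext x
      simp [Fin.prod_univ_succ, Fin.tail]
    · simp [List.ofFn_succ]
  | zero =>
    convert Submodule.zero_mem _ using 1
    refine Prod.ext ?_ ?_
    · ext x; simp
    · simp
  | add F G _ _ hF hG =>
    convert Submodule.add_mem _ hF hG using 1
    refine Prod.ext ?_ ?_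
    · ext x; simp [mul_add]
    · simp [mul_add]
  | smul c F _ hF =>
    convert Submodule.smul_mem _ c hF using 1
    refine Prod.ext ?_ ?_
    · ext x; simp only [Prod.smul_fst, Pi.smul_apply, smul_eq_mul]; ring
    · simp only [Prod.smul_snd, mul_smul_comm]

/-- Splitting off the first pair (λ_1, μ_1) on the function side corresponds to splitting off the
first factor of E^N; both are Cauchy products in the two degrees. -/
theorem sum_pow_mul_sum_pow_mem_orderedPairs [CompleteSpace H] (A B : H →L[ℂ] H) (N p q : ℕ) :
    ((fun x : Fin N → ℝ × ℝ => ((p.factorial : ℝ)⁻¹ * (∑ l, (x l).1) ^ p) *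
      ((q.factorial : ℝ)⁻¹ * (∑ l, (x l).2) ^ q)), coeff₂ p q (expSeries A B ^ N)) ∈
      orderedPairs A B N := by
  induction N generalizing p q with
  | zero =>
    by_cases h : p = 0 ∧ q = 0
    · obtain ⟨rfl, rfl⟩ := h
      refine Submodule.subset_span ⟨(0, 0), ?_⟩
      refine Prod.ext ?_ ?_
      · ext x; simp
      · simp [coeff₂_one]
    · convert Submodule.zero_mem _ using 1
      refine Prod.ext ?_ ?_
      · ext x
        rcases not_and_or.1 h with h | h <;> simp [h]
      · simp [coeff₂_one, h]
  | succ N ih =>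
    have h := Submodule.sum_mem (orderedPairs A B (N + 1))
      (t := Finset.HasAntidiagonal.antidiagonal p) fun x _ => Submodule.sum_mem _
        (t := Finset.HasAntidiagonal.antidiagonal q) fun y _ => Submodule.smul_mem _
          ((x.1.factorial : ℝ)⁻¹ * (y.1.factorial : ℝ)⁻¹)
          (cons_mem_orderedPairs (ih x.2 y.2) x.1 y.1)
    convert h using 1
    refine Prod.ext ?_ ?_
    · ext z
      simp only [Prod.fst_sum, Finset.sum_apply, Prod.smul_fst, Pi.smul_apply, smul_eq_mul]
      rw [Fin.sum_univ_succ, Fin.sum_univ_succ, inv_factorial_mul_add_pow,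
        inv_factorial_mul_add_pow, Finset.sum_mul_sum]
      refine Finset.sum_congr rfl fun x _ => Finset.sum_congr rfl fun y _ => ?_
      simp only [Fin.tail]
      ring
    · simp only [Prod.snd_sum, Prod.smul_snd]
      rw [pow_succ', coeff₂_mul]
      refine Finset.sum_congr rfl fun x _ => Finset.sum_congr rfl fun y _ => ?_
      rw [coeff₂_expSeries, expCoeff, smul_mul_assoc]

theorem symmetrizedProduct_eq (A B : H →L[ℂ] H) (p q : ℕ) :
    symmetrizedProduct A B p q = ((p + q).choose q : ℝ)⁻¹ • wordSum A B (p + q) p := by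
  rw [symmetrizedProduct, sum_words_eq_wordSum]

theorem symmetrizedProduct_one_zero (A B : H →L[ℂ] H) : symmetrizedProduct A B 1 0 = A := by
  simp [symmetrizedProduct_eq, wordSum_succ_succ, wordSum_zero]

theorem symmetrizedProduct_zero_one (A B : H →L[ℂ] H) : symmetrizedProduct A B 0 1 = B := by
  simp [symmetrizedProduct_eq, wordSum_succ_zero, wordSum_zero]

theorem symmetrizedProduct_one_one (A B : H →L[ℂ] H) :
    symmetrizedProduct A B 1 1 = jordanProduct A B := by
  simp [symmetrizedProduct_eq, jordanProduct, wordSum_succ_succ, wordSum_succ_zero, wordSum_zero]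

variable [CompleteSpace H]

theorem isSelfAdjoint_symmetrizedProduct {A B : H →L[ℂ] H} (hA : IsSelfAdjoint A)
    (hB : IsSelfAdjoint B) (p q : ℕ) : IsSelfAdjoint (symmetrizedProduct A B p q) := by
  rw [symmetrizedProduct_eq]
  exact (IsSelfAdjoint.all _).smul (isSelfAdjoint_wordSum hA hB _ _)

theorem isStrongLimitOfIntegrals_monomial {A B : H →L[ℂ] H} {P₁ P₂ : PVM H}
    (h₁ : P₁.IsSpectralMeasureOf A) (h₂ : P₂.IsSpectralMeasureOf B) (p q : ℕ) :
    IsStrongLimitOfIntegrals P₁ P₂ (fun _ x => meanFst x ^ p * meanSnd x ^ q)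
      (symmetrizedProduct A B p q) := by
  -- The scalar turns divided powers of the sums into powers of the means.
  refine ⟨fun N => ((p.factorial : ℝ) * q.factorial / (N : ℝ) ^ (p + q)) •
    coeff₂ p q (expSeries A B ^ N), fun N hN Q hQ => ?_, fun ψ => ?_⟩
  · have h := (isOperatorIntegral_of_mem_orderedPairs h₁ h₂ hQ hN
      (sum_pow_mul_sum_pow_mem_orderedPairs A B N p q)).smul
        ((p.factorial : ℝ) * q.factorial / (N : ℝ) ^ (p + q))
    have e : (fun x : Fin N → ℝ × ℝ => meanFst x ^ p * meanSnd x ^ q) =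
        ((p.factorial : ℝ) * q.factorial / (N : ℝ) ^ (p + q)) •
          fun x : Fin N → ℝ × ℝ => ((p.factorial : ℝ)⁻¹ * (∑ l, (x l).1) ^ p) *
            ((q.factorial : ℝ)⁻¹ * (∑ l, (x l).2) ^ q) := by
      ext x
      have hp := Nat.factorial_ne_zero p
      have hq := Nat.factorial_ne_zero q
      simp only [meanFst, meanSnd, Pi.smul_apply, smul_eq_mul]
      rw [div_pow, div_pow, pow_add]
      field_simp
    rw [← e] at h
    exact ⟨h, fun T' hT' => hT'.eq h⟩
  · rw [symmetrizedProduct_eq]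
    exact ((ContinuousLinearMap.apply ℂ H ψ).continuous.tendsto _).comp
      (tendsto_smul_coeff₂_expSeries_pow A B p q)

theorem isStrongLimitOfIntegrals_sum {A B : H →L[ℂ] H} {P₁ P₂ : PVM H}
    (h₁ : P₁.IsSpectralMeasureOf A) (h₂ : P₂.IsSpectralMeasureOf B) (c : ℕ × ℕ →₀ ℝ) :
    IsStrongLimitOfIntegrals P₁ P₂
      (fun _ x => c.sum fun pq r => r * (meanFst x ^ pq.1 * meanSnd x ^ pq.2))
      (c.sum fun pq r => r • symmetrizedProduct A B pq.1 pq.2) := by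
  simp only [Finsupp.sum]
  induction c.support using Finset.induction_on with
  | empty => simpa using (isStrongLimitOfIntegrals_monomial h₁ h₂ 0 0).const_mul 0
  | insert a s ha ih =>
    simp only [Finset.sum_insert ha]
    exact ((isStrongLimitOfIntegrals_monomial h₁ h₂ a.1 a.2).const_mul (c a)).add ih

end RegularizedIntegral

end

open RegularizedIntegral
theorem theorem3p2
    {H : Type*} [NormedAddCommGroup H] [InnerProductSpace ℂ H] [CompleteSpace H]
    [TopologicalSpace.SeparableSpace H]
    (A B : H →L[ℂ] H) (hA : IsSelfAdjoint A) (hB : IsSelfAdjoint B) :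
    -- (a) real linear combinations
    (∀ a b : ℝ, IsStrongLimitOfIntegrals (spectralPVM A hA) (spectralPVM B hB)
      (fun _ x => a * meanFst x + b * meanSnd x) (a • A + b • B)) ∧
    -- (b) the Jordan product
    IsStrongLimitOfIntegrals (spectralPVM A hA) (spectralPVM B hB)
      (fun _ x => meanFst x * meanSnd x) (jordanProduct A B) ∧
    -- (c) symmetrized products are selfadjoint, and real linear combinations of them are limits
    (∀ p q : ℕ, IsSelfAdjoint (symmetrizedProduct A B p q)) ∧
    (∀ c : ℕ × ℕ →₀ ℝ, IsStrongLimitOfIntegrals (spectralPVM A hA) (spectralPVM B hB)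
      (fun _ x => c.sum fun pq r => r * (meanFst x ^ pq.1 * meanSnd x ^ pq.2))
      (c.sum fun pq r => r • symmetrizedProduct A B pq.1 pq.2)) := by
  have h₁ := spectralPVM_isSpectralMeasureOf A hA
  have h₂ := spectralPVM_isSpectralMeasureOf B hB
  have hmon := isStrongLimitOfIntegrals_monomial h₁ h₂
  refine ⟨fun a b => ?_, ?_, isSelfAdjoint_symmetrizedProduct hA hB,
    isStrongLimitOfIntegrals_sum h₁ h₂⟩
  · have h := ((hmon 1 0).const_mul a).add ((hmon 0 1).const_mul b)
    simpa only [pow_one, pow_zero, mul_one, one_mul, symmetrizedProduct_one_zero,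
      symmetrizedProduct_zero_one] using h
  · have h := hmon 1 1
    simpa only [pow_one, symmetrizedProduct_one_one] using h
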